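/- Let \(N\ge 3\), let \(\Omega\subset\mathbb R^N\) be a bounded domain, and let \(H^1_0(\Omega)\) be the closure of \(C_c^\infty(\Omega)\) in \(H^1(\Omega)\), with inner product \(\langle u,v\rangle=\int_\Omega\nabla u\cdot\nabla v\,dx\) and norm \(\|u\|=\langle u,u\rangle^{1/2}\). Let \(a\in C^1(\overline\Omega)\) with \(a>0\) in \(\Omega\), let \(\mu\ge 0\), \(0<t<2\), \(2^*(t)=\frac{2(N-t)}{N-2}\) and \(2^*=2^*(0)=\frac{2N}{N-2}\). Let \(0<\varepsilon_0<2^*(t)-2\) and let \((\varepsilon_n)\) be a sequence in \((0,\varepsilon_0)\). Assume that \[ \lambda_1:=\inf_{u\in H^1_0(\Omega),\,u\neq 0}\frac{\int_\Omega|\nabla u|^2dx}{\int_\Omega a(x)u^2dx}>1 . \] For \(u\in H^1_0(\Omega)\) put \[ I_n(u)=\frac12\int_\Omega|\nabla u|^2dx-\frac12\int_\Omega a(x)|u|^2dx-\frac{\mu}{2^*-\varepsilon_n}\int_\Omega|u|^{2^*-\varepsilon_n}dx-\frac1{2^*(t)-\varepsilon_n}\int_\Omega\frac{|u|^{2^*(t)-\varepsilon_n}}{|x|^t}dx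 . \] Then every \(I_n\) is differentiable on \(H^1_0(\Omega)\). Let \(I_n'\) denote its gradient in the Hilbert space \(H^1_0(\Omega)\), let \(K_n:H^1_0(\Omega)\to H^1_0(\Omega)\) be defined by \(I_n'(u)=u-K_n(u)\), and let \(\mathcal K_n=\{u\in H^1_0(\Omega):I_n'(u)=0\}\) be the set of critical points of \(I_n\). Let \(\mathcal P=\{u\in H^1_0(\Omega):u\ge 0\text{ a.e. in }\Omega\}\) and, for \(\delta>0\), \(\mathcal D(\delta)=\{u\in H^1_0(\Omega):\operatorname{dist}(u,\mathcal P)<\delta\}\), the distance being that of the norm \(\|\cdot\|\). Then there is \(\Delta>0\), independent of \(n\), such that for every \(\delta_0\in(0,\Delta)\) the following holds. There is \(\delta\in(0,\delta_0)\), independent of \(n\), such that for all \(n\) \[ K_n(\mathcal D(\delta_0))\subset\mathcal D(\delta)\subset\mathcal D(\delta_0) \quad\text{and}\quad K_n(-\mathcal D(\delta_0))\subset-\mathcal D(\delta)\subset-\mathcal D(\delta_0). \] Moreover, for all \(n\), \(\mathcal D(\delta_0)\cap\mathcal K_n\subset\mathcal P\) and \(-\mathcal D(\delta_0)\cap\mathcal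 K_n\subset-\mathcal P\); that is, every critical point of \(I_n\) in \(\mathcal D(\delta_0)\) is nonnegative and every one in \(-\mathcal D(\delta_0)\) is nonpositive. -/

import Mathlib

open MeasureTheory Set Filter Topology
open scoped NNReal ENNReal Pointwise ContDiff

noncomputable section

namespace HardySobolev

/-- A bounded domain (nonempty, connected, open, bounded set) in `ℝ^N`, where `N ≥ 3`. -/
structure BoundedDomain (N : ℕ) where
  /-- the underlying set of points -/
  carrier : Set (EuclideanSpace ℝ (Fin N))
  three_le : 3 ≤ N
  isOpen : IsOpen carrier
  isConnected : IsConnected carrier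
  isBounded : Bornology.IsBounded carrier

variable {N : ℕ}

/-- `C^∞` functions with compact support contained in `Ω`. -/
def IsTest (Ω : Set (EuclideanSpace ℝ (Fin N))) (φ : EuclideanSpace ℝ (Fin N) → ℝ) : Prop :=
  ContDiff ℝ ∞ φ ∧ HasCompactSupport φ ∧ tsupport φ ⊆ Ω

/-- The ambient space `L²(Ω) × L²(Ω; ℝ^N)`, which contains the pairs `(u, ∇u)`. -/
abbrev L2Pair (Ω : Set (EuclideanSpace ℝ (Fin N))) : Type :=
  Lp ℝ 2 (volume.restrict Ω) × Lp (EuclideanSpace ℝ (Fin N)) 2 (volume.restrict Ω)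

/-- The space of all pairs `(φ, ∇φ)`, with `φ` a test function on `Ω`. -/
def testPairs (Ω : Set (EuclideanSpace ℝ (Fin N))) : Submodule ℝ (L2Pair Ω) where
  carrier := {p | ∃ φ, IsTest Ω φ ∧ p.1 =ᵐ[volume.restrict Ω] φ ∧
    p.2 =ᵐ[volume.restrict Ω] gradient φ}
  zero_mem' := by
    refine ⟨0, ⟨contDiff_const, HasCompactSupport.zero, by simp [tsupport]⟩, Lp.coeFn_zero _ _ _, ?_⟩
    have h : gradient (0 : EuclideanSpace ℝ (Fin N) → ℝ) = 0 := by
      funext x; simp [gradient]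
    rw [h]; exact Lp.coeFn_zero _ _ _
  add_mem' := by
    rintro p q ⟨φ, ⟨h1, h2, h3⟩, h4, h5⟩ ⟨ψ, ⟨k1, k2, k3⟩, k4, k5⟩
    refine ⟨φ + ψ, ⟨h1.add k1, h2.add k2,
      (tsupport_add φ ψ).trans (union_subset h3 k3)⟩,
      (Lp.coeFn_add _ _).trans (h4.add k4), ?_⟩
    have h : gradient (φ + ψ) = gradient φ + gradient ψ := by
      funext x
      simp only [gradient, Pi.add_apply]
      rw [fderiv_add (h1.differentiable (by simp) x) (k1.differentiable (by simp) x), map_add]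
    rw [h]; exact (Lp.coeFn_add _ _).trans (h5.add k5)
  smul_mem' := by
    rintro c p ⟨φ, ⟨h1, h2, h3⟩, h4, h5⟩
    refine ⟨c • φ, ⟨h1.const_smul c, h2.smul_left (f := fun _ => c),
      (tsupport_smul_subset_right (fun _ => c) φ).trans h3⟩,
      (Lp.coeFn_smul _ _).trans (h4.const_smul c), ?_⟩
    have h : gradient (c • φ) = c • gradient φ := by
      funext x
      simp only [gradient, Pi.smul_apply]
      rw [fderiv_const_smul (h1.differentiable (by simp) x), map_smul]
    rw [h]; exact (Lp.coeFn_smul _ _).trans (h5.const_smul c)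

/-- The Sobolev space `H^1_0(Ω)`: the closure of the test functions in `H^1(Ω)`. An element is
represented by the pair of `u ∈ L²(Ω)` and its weak gradient `∇u ∈ L²(Ω; ℝ^N)`. -/
def H10 (Ω : BoundedDomain N) : Type := ↥(testPairs Ω.carrier).topologicalClosure

namespace H10

variable {Ω : BoundedDomain N}

instance : AddCommGroup (H10 Ω) :=
  inferInstanceAs (AddCommGroup ↥(testPairs Ω.carrier).topologicalClosure)

instance : Module ℝ (H10 Ω) :=
  inferInstanceAs (Module ℝ ↥(testPairs Ω.carrier).topologicalClosure)

/-- The linear inclusion `u ↦ (u, ∇u)` of `H^1_0(Ω)` in `L²(Ω) × L²(Ω; ℝ^N)`. -/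
def toPair : H10 Ω →ₗ[ℝ] L2Pair Ω.carrier := (testPairs Ω.carrier).topologicalClosure.subtype

/-- `u` as an element of `L²(Ω)`. -/
def val (u : H10 Ω) : Lp ℝ 2 (volume.restrict Ω.carrier) := (toPair u).1

/-- The weak gradient `∇u`, as an element of `L²(Ω; ℝ^N)`. -/
def grad (u : H10 Ω) : Lp (EuclideanSpace ℝ (Fin N)) 2 (volume.restrict Ω.carrier) :=
  (toPair u).2

instance : CoeFun (H10 Ω) (fun _ => EuclideanSpace ℝ (Fin N) → ℝ) := ⟨fun u x => u.val x⟩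

end H10

/-- The Poincaré inequality for test functions. -/
lemma poincare_test (Ω : BoundedDomain N) :
    ∃ C : ℝ≥0, ∀ p ∈ testPairs Ω.carrier, ‖p.1‖ ≤ C * ‖p.2‖ := by
  refine ⟨eLpNormLESNormFDerivOfLeConst ℝ volume Ω.carrier 2 2, ?_⟩
  rintro p ⟨φ, ⟨h1, h2, h3⟩, h4, h5⟩
  have hs : φ.support ⊆ Ω.carrier := (subset_tsupport φ).trans h3
  have hP := eLpNorm_le_eLpNorm_fderiv (μ := volume) (p := 2) (h1.of_le (by simp)) hs (by norm_num)
    (by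
      have h := Ω.three_le
      rw [finrank_euclideanSpace_fin]
      have h' : (3 : ℝ) ≤ N := by exact_mod_cast h
      linarith) Ω.isBounded
  rw [Lp.norm_def, Lp.norm_def, eLpNorm_congr_ae h4, eLpNorm_congr_ae h5]
  have hg : eLpNorm (gradient φ) 2 (volume.restrict Ω.carrier) = eLpNorm (fderiv ℝ φ) 2 volume := by
    rw [← eLpNorm_restrict_eq_of_support_subset (f := fderiv ℝ φ)
      (show (fderiv ℝ φ).support ⊆ Ω.carrier from (support_fderiv_subset ℝ).trans h3)]
    refine eLpNorm_congr_norm_ae (Eventually.of_forall fun x => ?_)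
    simp [gradient]
  have hfin : eLpNorm (gradient φ) 2 (volume.restrict Ω.carrier) ≠ ⊤ := by
    rw [← eLpNorm_congr_ae h5]; exact Lp.eLpNorm_ne_top _
  have hle : eLpNorm φ 2 (volume.restrict Ω.carrier) ≤
      eLpNormLESNormFDerivOfLeConst ℝ volume Ω.carrier 2 2 *
        eLpNorm (gradient φ) 2 (volume.restrict Ω.carrier) := by
    rw [hg, eLpNorm_restrict_eq_of_support_subset hs]
    exact hP
  have := ENNReal.toReal_mono (ENNReal.mul_ne_top ENNReal.coe_ne_top hfin) hle
  rwa [ENNReal.toReal_mul, ENNReal.coe_toReal] at this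

namespace H10

variable {Ω : BoundedDomain N}

/-- The Poincaré inequality on `H^1_0(Ω)`. -/
lemma poincare (Ω : BoundedDomain N) : ∃ C : ℝ≥0, ∀ u : H10 Ω, ‖u.val‖ ≤ C * ‖u.grad‖ := by
  obtain ⟨C, hC⟩ := poincare_test Ω
  refine ⟨C, fun u => ?_⟩
  have hcl : IsClosed {p : L2Pair Ω.carrier | ‖p.1‖ ≤ C * ‖p.2‖} :=
    isClosed_le (by fun_prop) (by fun_prop)
  exact closure_minimal (fun p hp => hC p hp) hcl u.2

lemma toPair_injective : Function.Injective (toPair : H10 Ω →ₗ[ℝ] L2Pair Ω.carrier) :=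
  Subtype.val_injective

/-- The inner product `⟨u, v⟩ = ∫_Ω ∇u · ∇v` of `H^1_0(Ω)`. -/
@[reducible] def core (Ω : BoundedDomain N) : InnerProductSpace.Core ℝ (H10 Ω) where
  inner u v := inner ℝ u.grad v.grad
  conj_inner_symm u v := by simp [real_inner_comm]
  re_inner_nonneg u := by simp
  add_left u v w := by simp [grad, inner_add_left]
  smul_left u v c := by simp [grad, real_inner_smul_left]
  definite u hu := by
    have h2 : u.grad = 0 := inner_self_eq_zero.mp hu
    obtain ⟨C, hC⟩ := poincare Ω
    have h1 : u.val = 0 := by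
      have := hC u
      rw [h2, norm_zero, mul_zero] at this
      exact norm_le_zero_iff.mp this
    apply toPair_injective
    rw [map_zero]
    exact Prod.ext h1 h2

instance : NormedAddCommGroup (H10 Ω) := (core Ω).toNormedAddCommGroup

instance : InnerProductSpace ℝ (H10 Ω) := InnerProductSpace.ofCore (core Ω).toCore

lemma inner_eq (u v : H10 Ω) : inner ℝ u v = inner ℝ u.grad v.grad := rfl

lemma norm_eq (u : H10 Ω) : ‖u‖ = ‖u.grad‖ := by
  rw [@norm_eq_sqrt_real_inner (H10 Ω), inner_eq, ← norm_eq_sqrt_real_inner]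

instance : CompleteSpace (H10 Ω) := by
  obtain ⟨C, hC⟩ := poincare Ω
  have hlip : LipschitzWith (max C 1) (toPair : H10 Ω →ₗ[ℝ] L2Pair Ω.carrier) := by
    refine AddMonoidHomClass.lipschitz_of_bound_nnnorm _ _ fun u => ?_
    rw [← NNReal.coe_le_coe]
    push_cast
    rw [norm_eq u, Prod.norm_def]
    refine max_le ((hC u).trans ?_) ?_
    · gcongr; exact le_max_left _ _
    · exact le_mul_of_one_le_left (norm_nonneg _) (le_max_right _ _)
  have hanti : AntilipschitzWith 1 (toPair : H10 Ω →ₗ[ℝ] L2Pair Ω.carrier) := by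
    refine AddMonoidHomClass.antilipschitz_of_bound _ fun u => ?_
    rw [norm_eq u, NNReal.coe_one, one_mul]
    exact norm_snd_le (toPair u)
  rw [completeSpace_iff_isComplete_range (hanti.isUniformInducing hlip.uniformContinuous)]
  have hr : range (toPair : H10 Ω →ₗ[ℝ] L2Pair Ω.carrier) =
      ((testPairs Ω.carrier).topologicalClosure : Set (L2Pair Ω.carrier)) := Subtype.range_val
  rw [hr]
  exact (Submodule.isClosed_topologicalClosure _).isComplete

end H10

/-- `a ∈ C^1(closure Ω)`: `a` is continuous on `closure Ω`, differentiable in `Ω`, and its gradient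
on `Ω` extends continuously to `closure Ω`. -/
def IsC1Closure (Ω : Set (EuclideanSpace ℝ (Fin N))) (a : EuclideanSpace ℝ (Fin N) → ℝ) : Prop :=
  ContinuousOn a (closure Ω) ∧
    ∃ g : EuclideanSpace ℝ (Fin N) → EuclideanSpace ℝ (Fin N),
      ContinuousOn g (closure Ω) ∧ ∀ x ∈ Ω, HasGradientAt a (g x) x

/-- The critical Hardy-Sobolev exponent `2^*(t) = 2 (N - t) / (N - 2)`; `2^* = 2^*(0)`. -/
def critExp (N : ℕ) (t : ℝ) : ℝ := 2 * (N - t) / (N - 2)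

variable (Ω : BoundedDomain N)

/-- `λ₁`, the infimum of `∫_Ω |∇u|² / ∫_Ω a u²` over all nonzero `u ∈ H^1_0(Ω)`. -/
def lambda1 (a : EuclideanSpace ℝ (Fin N) → ℝ) : ℝ :=
  sInf {r | ∃ u : H10 Ω, u ≠ 0 ∧
    r = (∫ x in Ω.carrier, ‖u.grad x‖ ^ 2) / ∫ x in Ω.carrier, a x * u x ^ 2}

/-- The energy functional
`½ ∫ |∇u|² - ½ ∫ a u² - μ/(2^*-ε) ∫ |u|^(2^*-ε) - 1/(2^*(t)-ε) ∫ |u|^(2^*(t)-ε) / |x|^t`. -/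
def energy (a : EuclideanSpace ℝ (Fin N) → ℝ) (μ t ε : ℝ) (u : H10 Ω) : ℝ :=
  1 / 2 * (∫ x in Ω.carrier, ‖u.grad x‖ ^ 2)
    - 1 / 2 * (∫ x in Ω.carrier, a x * |u x| ^ 2)
    - μ / (critExp N 0 - ε) * (∫ x in Ω.carrier, |u x| ^ (critExp N 0 - ε))
    - 1 / (critExp N t - ε) * (∫ x in Ω.carrier, |u x| ^ (critExp N t - ε) / ‖x‖ ^ t)

/-- The operator `K` on `H^1_0(Ω)` determined by `I'(u) = u - K(u)`, where `I'` is the gradient of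
the energy functional in the Hilbert space `H^1_0(Ω)`. -/
def opK (a : EuclideanSpace ℝ (Fin N) → ℝ) (μ t ε : ℝ) (u : H10 Ω) : H10 Ω :=
  u - gradient (energy Ω a μ t ε) u

/-- The set of critical points of the energy functional. -/
def critPts (a : EuclideanSpace ℝ (Fin N) → ℝ) (μ t ε : ℝ) : Set (H10 Ω) :=
  {u | gradient (energy Ω a μ t ε) u = 0}

/-- The cone `P` of all `u ∈ H^1_0(Ω)` with `u ≥ 0` (almost everywhere in `Ω`). -/
def cone : Set (H10 Ω) := {u | ∀ᵐ x ∂(volume.restrict Ω.carrier), 0 ≤ u x}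

/-- The neighbourhood `D(δ) = {u : dist(u, P) < δ}` of the cone. -/
def nbhd (δ : ℝ) : Set (H10 Ω) := {u | Metric.infDist u (cone Ω) < δ}

end HardySobolev

end

/-!
The gradient of the energy is `u - K(u)`, where `⟨K(u), φ⟩` is the sum of the integrals of
`a u φ`, `μ |u|^(q-2) u φ` and `|x|^(-t) |u|^(p-2) u φ`, with `q = 2^* - ε` and `p = 2^*(t) - ε`.
Split `v = K(u)` into `v⁺ - v⁻`. For every `w ≥ 0` the negative part of `u` is at most `|u - w|`,
so testing with `v⁻ ≥ 0` and applying Hölder's inequality gives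
`‖v⁻‖² ≤ -⟨v, v⁻⟩ ≤ (1/λ₁ + μ C₀ ‖u - w‖^(q-2) + C_t ‖u - w‖^(p-2)) ‖u - w‖ ‖v⁻‖`.
As `1/λ₁ < 1`, and as `p - 2` and `q - 2` are bounded below by a positive number, `K` contracts small
distances from the cone by a factor `κ < 1` (`exists_contraction`). A critical point is a fixed
point of `K`, so it lies in the cone as soon as its distance from the cone is small. The operator
`K` is odd, which gives the statements on `-P`.

The constants have to be uniform up to the critical exponents. Pointwise, Young's inequality bounds
`|x|^(-t) |u|^p`, for all `p ∈ [2, 2^*(t)]`, by `|u|²/|x|² + |u|² + |u|^(2^*)` (`rpow_div_rpow_le`), so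
the inequalities of Hardy, Poincaré and Sobolev give one constant for all `p` on the unit sphere of
`H^1_0(Ω)`, and homogeneity does the rest (`exists_isWeight`). Hardy's inequality comes from
integrating the divergence of `φ² x / (|x|² + s)` (`hardy_regularized`).

All three integral terms of the energy have the form `∫ W |u|^p` with `p ≥ 2`, and are treated
together: `IsWeight.exists_hasGradientAt` shows by a pointwise Taylor estimate that such a term is
differentiable with a quadratic remainder.

For the positive and negative parts, no chain rule is needed: it is enough that `|u|` belongs to
`H^1_0(Ω)` with norm at most `‖u‖` (`H10.exists_abs`), because `⟨v⁺, v⁻⟩ = (‖|v|‖² - ‖v‖²) / 4 ≤ 0`.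
This follows by weak compactness from the smooth approximations `√(φ² + η²) - η` of `|φ|`.
-/

namespace HardySobolev

/-! ### Hardy's and Sobolev's inequalities for smooth functions -/

/-- The Euler vector field `x` has divergence `N`. -/
lemma integral_fderiv_apply_self {N : ℕ} {ψ : EuclideanSpace ℝ (Fin N) → ℝ}
    (hψ : ContDiff ℝ 1 ψ) (hc : HasCompactSupport ψ) :
    ∫ x, fderiv ℝ ψ x x = -(N * ∫ x, ψ x) := by
  let b := EuclideanSpace.basisFun (Fin N) ℝ
  have hdc : HasCompactSupport (fderiv ℝ ψ) := hc.fderiv ℝ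
  have hcont : Continuous (fderiv ℝ ψ) := hψ.continuous_fderiv (by simp)
  have hint (i : Fin N) : Integrable fun x : EuclideanSpace ℝ (Fin N) =>
      x i * fderiv ℝ ψ x (b i) := by
    refine Continuous.integrable_of_hasCompactSupport (by fun_prop) ?_
    refine hdc.mono fun x hx => ?_
    contrapose! hx
    simp only [Function.mem_support, not_not] at hx ⊢
    simp [hx]
  have hpart (i : Fin N) : ∫ x : EuclideanSpace ℝ (Fin N), x i * fderiv ℝ ψ x (b i) =
      -∫ x, ψ x := by
    have hd (x : EuclideanSpace ℝ (Fin N)) :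
        fderiv ℝ (fun x : EuclideanSpace ℝ (Fin N) => x i) x (b i) = 1 := by
      have : (fun x : EuclideanSpace ℝ (Fin N) => x i) =
          (EuclideanSpace.proj i : EuclideanSpace ℝ (Fin N) →L[ℝ] ℝ) := rfl
      rw [this, ContinuousLinearMap.fderiv]
      simp [b]
    have h := integral_mul_fderiv_eq_neg_fderiv_mul_of_integrable (μ := volume) (𝕜 := ℝ)
      (f := fun x : EuclideanSpace ℝ (Fin N) => x i) (g := ψ) (v := b i)
      (by simp only [hd, one_mul]; exact hψ.continuous.integrable_of_hasCompactSupport hc)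
      (hint i)
      (by
        refine Continuous.integrable_of_hasCompactSupport ?_ hc.mul_left
        have := hψ.continuous
        fun_prop)
      (fun x _ => by fun_prop) (fun x _ => hψ.differentiable (by simp) x)
    simpa only [hd, one_mul] using h
  have hsum (x : EuclideanSpace ℝ (Fin N)) :
      fderiv ℝ ψ x x = ∑ i, x i * fderiv ℝ ψ x (b i) := by
    have h : fderiv ℝ ψ x (∑ i, b.repr x i • b i) = ∑ i, x i * fderiv ℝ ψ x (b i) := by
      rw [map_sum]
      exact Finset.sum_congr rfl fun i _ => by simp [b]
    rwa [b.sum_repr x] at h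
  simp_rw [hsum]
  rw [integral_finsetSum _ fun i _ => hint i]
  simp [hpart]

/-- Hardy's inequality with the weight `1 / |x|²` replaced by the smooth weight
`1 / (|x|² + s)`. -/
lemma hardy_regularized {N : ℕ} (hN : 3 ≤ N) {φ : EuclideanSpace ℝ (Fin N) → ℝ}
    (hφ : ContDiff ℝ 1 φ) (hc : HasCompactSupport φ) {s : ℝ} (hs : 0 < s) :
    Integrable (fun x => φ x ^ 2 * (‖x‖ ^ 2 + s)⁻¹) ∧
    ∫ x, φ x ^ 2 * (‖x‖ ^ 2 + s)⁻¹ ≤ 4 * ∫ x, ‖fderiv ℝ φ x‖ ^ 2 := by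
  set ψ : EuclideanSpace ℝ (Fin N) → ℝ := fun x => φ x ^ 2 * (‖x‖ ^ 2 + s)⁻¹ with hψdef
  have hpos (x : EuclideanSpace ℝ (Fin N)) : 0 < ‖x‖ ^ 2 + s := by positivity
  have hψ : ContDiff ℝ 1 ψ := by
    refine (hφ.pow 2).mul (ContDiff.inv ?_ fun x => (hpos x).ne')
    exact (contDiff_id.norm_sq ℝ).add contDiff_const
  have hψc : HasCompactSupport ψ := by
    refine hc.mono fun x hx => ?_
    contrapose! hx
    simp only [Function.mem_support, not_not] at hx ⊢
    simp [hψdef, hx]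
  have hint : Integrable ψ := hψ.continuous.integrable_of_hasCompactSupport hψc
  have hintd : Integrable fun x => fderiv ℝ ψ x x := by
    refine Continuous.integrable_of_hasCompactSupport
      ((hψ.continuous_fderiv (by simp)).clm_apply continuous_id) ?_
    refine (hψc.fderiv ℝ).mono fun x hx => ?_
    contrapose! hx
    simp only [Function.mem_support, not_not] at hx ⊢
    simp [hx]
  have hintg : Integrable fun x => ‖fderiv ℝ φ x‖ ^ 2 := by
    refine Continuous.integrable_of_hasCompactSupport
      ((hφ.continuous_fderiv (by simp)).norm.pow 2) ?_
    refine (hc.fderiv ℝ).mono fun x hx => ?_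
    contrapose! hx
    simp only [Function.mem_support, not_not] at hx ⊢
    simp [hx]
  refine ⟨hint, ?_⟩
  have hfd (x : EuclideanSpace ℝ (Fin N)) : fderiv ℝ ψ x x =
      2 * φ x * (‖x‖ ^ 2 + s)⁻¹ * fderiv ℝ φ x x
        - 2 * φ x ^ 2 * ‖x‖ ^ 2 * (‖x‖ ^ 2 + s)⁻¹ ^ 2 := by
    have h1 : HasFDerivAt φ (fderiv ℝ φ x) x := (hφ.differentiable (by simp) x).hasFDerivAt
    have h2 : HasFDerivAt (fun x : EuclideanSpace ℝ (Fin N) => ‖x‖ ^ 2 + s)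
        (2 • (innerSL ℝ x)) x := (hasStrictFDerivAt_norm_sq x).hasFDerivAt.add_const s
    have h3 := (h1.pow 2).mul ((hasDerivAt_inv (hpos x).ne').comp_hasFDerivAt x h2)
    have h4 : fderiv ℝ ψ x = _ := h3.fderiv
    rw [h4]
    simp only [add_apply, smul_apply, innerSL_apply_apply,
      real_inner_self_eq_norm_sq, smul_eq_mul, nsmul_eq_mul, Function.comp_apply, inv_pow]
    push_cast
    ring
  have hpt (x : EuclideanSpace ℝ (Fin N)) :
      2⁻¹ * ψ x - 2 * ‖fderiv ℝ φ x‖ ^ 2 ≤ N * ψ x + fderiv ℝ ψ x x := by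
    rw [hfd]
    have hρ : 0 < (‖x‖ ^ 2 + s)⁻¹ := inv_pos.mpr (hpos x)
    have hρ1 : ‖x‖ ^ 2 * (‖x‖ ^ 2 + s)⁻¹ ≤ 1 := by
      rw [← div_eq_mul_inv, div_le_one (hpos x)]; linarith
    have hd : |fderiv ℝ φ x x| ≤ ‖fderiv ℝ φ x‖ * ‖x‖ := (fderiv ℝ φ x).le_opNorm x
    have hN' : (3 : ℝ) ≤ N := by exact_mod_cast hN
    simp only [hψdef]
    set ρ := (‖x‖ ^ 2 + s)⁻¹
    set G := ‖fderiv ℝ φ x‖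
    set D := fderiv ℝ φ x x
    set A := φ x ^ 2 * ρ
    have hA : 0 ≤ A := by positivity
    have h1 : (φ x * ρ) ^ 2 * ‖x‖ ^ 2 ≤ A := by
      have : (φ x * ρ) ^ 2 * ‖x‖ ^ 2 = A * (‖x‖ ^ 2 * ρ) := by simp only [A]; ring
      rw [this]; exact mul_le_of_le_one_right hA hρ1
    have h2 : -(2 * φ x * ρ * D) ≤ 2⁻¹ * A + 2 * G ^ 2 := by
      have h3 : -(φ x * ρ * D) ≤ |φ x * ρ| * (G * ‖x‖) := by
        refine (neg_le_abs _).trans ?_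
        rw [abs_mul]; gcongr
      have h4 : |φ x * ρ| ^ 2 = (φ x * ρ) ^ 2 := sq_abs _
      nlinarith [sq_nonneg (|φ x * ρ| * ‖x‖ - 2 * G)]
    have h5 : 2 * φ x ^ 2 * ‖x‖ ^ 2 * ρ ^ 2 ≤ 2 * A := by
      have : 2 * φ x ^ 2 * ‖x‖ ^ 2 * ρ ^ 2 = 2 * ((φ x * ρ) ^ 2 * ‖x‖ ^ 2) := by ring
      linarith
    nlinarith [mul_le_mul_of_nonneg_right hN' hA]
  have hI := integral_mono ((hint.const_mul 2⁻¹).sub (hintg.const_mul 2))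
    ((hint.const_mul (N : ℝ)).add hintd) hpt
  simp only [Pi.sub_apply, Pi.add_apply] at hI
  rw [integral_sub (hint.const_mul 2⁻¹) (hintg.const_mul 2),
    integral_add (hint.const_mul (N : ℝ)) hintd, integral_fderiv_apply_self hψ hψc,
    integral_const_mul, integral_const_mul, integral_const_mul] at hI
  linarith

/-- **Hardy's inequality** for functions in `C_c^1(ℝ^N)`, `N ≥ 3`. -/
lemma hardy_smooth {N : ℕ} (hN : 3 ≤ N) {φ : EuclideanSpace ℝ (Fin N) → ℝ}
    (hφ : ContDiff ℝ 1 φ) (hc : HasCompactSupport φ) :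
    ∫⁻ x, ENNReal.ofReal (φ x ^ 2 * (‖x‖ ^ 2)⁻¹) ≤
      ENNReal.ofReal (4 * ∫ x, ‖fderiv ℝ φ x‖ ^ 2) := by
  set s : ℕ → ℝ := fun k => 1 / ((k : ℝ) + 1)
  have hs0 (k : ℕ) : 0 < s k := by positivity
  have hs : Tendsto s atTop (𝓝 0) := tendsto_one_div_add_atTop_nhds_zero_nat
  calc ∫⁻ x, ENNReal.ofReal (φ x ^ 2 * (‖x‖ ^ 2)⁻¹)
      ≤ ∫⁻ x, liminf (fun k => ENNReal.ofReal (φ x ^ 2 * (‖x‖ ^ 2 + s k)⁻¹)) atTop := by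
        refine lintegral_mono fun x => ?_
        rcases eq_or_ne x 0 with rfl | hx
        · simp
        · have hx2 : ‖x‖ ^ 2 + 0 ≠ 0 := by simpa using hx
          have : Tendsto (fun k => φ x ^ 2 * (‖x‖ ^ 2 + s k)⁻¹) atTop
              (𝓝 (φ x ^ 2 * (‖x‖ ^ 2 + 0)⁻¹)) :=
            ((hs.const_add _).inv₀ hx2).const_mul _
          rw [(ENNReal.tendsto_ofReal this).liminf_eq, add_zero]
    _ ≤ liminf (fun k => ∫⁻ x, ENNReal.ofReal (φ x ^ 2 * (‖x‖ ^ 2 + s k)⁻¹)) atTop := by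
        refine lintegral_liminf_le' fun k => ?_
        exact (hardy_regularized hN hφ hc (hs0 k)).1.aestronglyMeasurable.aemeasurable.ennreal_ofReal
    _ ≤ ENNReal.ofReal (4 * ∫ x, ‖fderiv ℝ φ x‖ ^ 2) := by
        refine (liminf_le_liminf (Eventually.of_forall fun k => ?_)).trans_eq
          (liminf_const (f := atTop) (ENNReal.ofReal (4 * ∫ x, ‖fderiv ℝ φ x‖ ^ 2)))
        obtain ⟨h1, h2⟩ := hardy_regularized hN hφ hc (hs0 k)
        rw [← ofReal_integral_eq_lintegral_ofReal h1
          (Eventually.of_forall fun x => by have := hs0 k; positivity)]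
        exact ENNReal.ofReal_le_ofReal h2

variable {N : ℕ} {Ω : BoundedDomain N}

/-- The `L²(Ω)` norm of the gradient of a test function is the `L²` norm over `ℝ^N` of its
Fréchet derivative. -/
lemma eLpNorm_fderiv_eq_of_mem_testPairs {p : L2Pair Ω.carrier}
    {φ : EuclideanSpace ℝ (Fin N) → ℝ} (hφ : IsTest Ω.carrier φ)
    (hp : p.2 =ᵐ[volume.restrict Ω.carrier] gradient φ) :
    eLpNorm (fderiv ℝ φ) 2 volume = ENNReal.ofReal ‖p.2‖ := by
  rw [Lp.norm_def, ENNReal.ofReal_toReal (Lp.eLpNorm_ne_top _), eLpNorm_congr_ae hp,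
    ← eLpNorm_restrict_eq_of_support_subset (f := fderiv ℝ φ)
      (show (fderiv ℝ φ).support ⊆ Ω.carrier from (support_fderiv_subset ℝ).trans hφ.2.2)]
  exact eLpNorm_congr_norm_ae (Eventually.of_forall fun x => by simp [gradient])

lemma hardy_test {p : L2Pair Ω.carrier} (hp : p ∈ testPairs Ω.carrier) :
    ∫⁻ x in Ω.carrier, ENNReal.ofReal ((‖x‖ ^ 2)⁻¹ * |p.1 x| ^ (2 : ℝ)) ≤
      ENNReal.ofReal (4 * ‖p.2‖ ^ (2 : ℝ)) := by
  obtain ⟨φ, hφ, h1, h2⟩ := hp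
  have hint : Integrable fun x => ‖fderiv ℝ φ x‖ ^ 2 := by
    refine Continuous.integrable_of_hasCompactSupport
      ((hφ.1.continuous_fderiv (by simp)).norm.pow 2) ?_
    refine (hφ.2.1.fderiv ℝ).mono fun x hx => ?_
    contrapose! hx
    simp only [Function.mem_support, not_not] at hx ⊢
    simp [hx]
  have hnorm : ‖p.2‖ ^ 2 = ∫ x, ‖fderiv ℝ φ x‖ ^ 2 := by
    have h := eLpNorm_fderiv_eq_of_mem_testPairs hφ h2
    have hm : MemLp (fderiv ℝ φ) 2 volume :=
      (hφ.1.continuous_fderiv (by simp)).memLp_of_hasCompactSupport (hφ.2.1.fderiv ℝ)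
    rw [hm.eLpNorm_eq_integral_rpow_norm (by simp) (by simp)] at h
    rw [ENNReal.ofReal_eq_ofReal_iff (by positivity) (norm_nonneg _)] at h
    rw [← h]
    simp only [ENNReal.toReal_ofNat, Real.rpow_two]
    rw [← Real.rpow_natCast, ← Real.rpow_mul (integral_nonneg fun x => by positivity)]
    simp
  calc ∫⁻ x in Ω.carrier, ENNReal.ofReal ((‖x‖ ^ 2)⁻¹ * |p.1 x| ^ (2 : ℝ))
      = ∫⁻ x in Ω.carrier, ENNReal.ofReal (φ x ^ 2 * (‖x‖ ^ 2)⁻¹) := by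
        refine lintegral_congr_ae ?_
        filter_upwards [h1] with x hx
        rw [hx, Real.rpow_two, sq_abs, mul_comm]
    _ ≤ ∫⁻ x, ENNReal.ofReal (φ x ^ 2 * (‖x‖ ^ 2)⁻¹) := setLIntegral_le_lintegral _ _
    _ ≤ ENNReal.ofReal (4 * ∫ x, ‖fderiv ℝ φ x‖ ^ 2) :=
        hardy_smooth Ω.three_le (hφ.1.of_le (by simp)) hφ.2.1
    _ = _ := by rw [Real.rpow_two, hnorm]

lemma poincare_lintegral_test (Ω : BoundedDomain N) :
    ∃ C : ℝ, 0 ≤ C ∧ ∀ p ∈ testPairs Ω.carrier,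
      ∫⁻ x in Ω.carrier, ENNReal.ofReal (1 * |p.1 x| ^ (2 : ℝ)) ≤
        ENNReal.ofReal (C * ‖p.2‖ ^ (2 : ℝ)) := by
  obtain ⟨C, hC⟩ := poincare_test Ω
  refine ⟨C ^ 2, by positivity, fun p hp => ?_⟩
  have h := Lp.eLpNorm_ne_top p.1
  have h2 : ∫⁻ x in Ω.carrier, ENNReal.ofReal (1 * |p.1 x| ^ (2 : ℝ)) =
      eLpNorm p.1 2 (volume.restrict Ω.carrier) ^ (2 : ℝ) := by
    rw [eLpNorm_eq_lintegral_rpow_enorm_toReal (by simp) (by simp), ← ENNReal.rpow_mul]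
    simp only [ENNReal.toReal_ofNat, one_mul]
    norm_num
    refine lintegral_congr fun x => ?_
    rw [← sq_abs, ← Real.norm_eq_abs, ENNReal.ofReal_pow (norm_nonneg _), ofReal_norm]
  rw [h2, ← ENNReal.ofReal_toReal h, ← Lp.norm_def,
    ENNReal.ofReal_rpow_of_nonneg (norm_nonneg _) (by norm_num)]
  refine ENNReal.ofReal_le_ofReal ?_
  rw [Real.rpow_two, Real.rpow_two, ← mul_pow]
  gcongr
  exact hC p hp

/-- **Sobolev's inequality** for test functions, with the critical exponent `2^*`. -/
lemma sobolev_test (Ω : BoundedDomain N) :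
    ∃ C : ℝ, 0 ≤ C ∧ ∀ p ∈ testPairs Ω.carrier,
      ∫⁻ x in Ω.carrier, ENNReal.ofReal (1 * |p.1 x| ^ critExp N 0) ≤
        ENNReal.ofReal (C * ‖p.2‖ ^ critExp N 0) := by
  have hN : (3 : ℝ) ≤ N := by exact_mod_cast Ω.three_le
  have hr : 0 < critExp N 0 := by
    unfold critExp
    exact div_pos (by linarith) (by linarith)
  set r : ℝ≥0 := ⟨critExp N 0, hr.le⟩ with hrdef
  have hrr : (r : ℝ) = critExp N 0 := rfl
  have hr0 : r ≠ 0 := by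
    intro h; rw [h] at hrr; simp at hrr; linarith
  set C : ℝ≥0 := SNormLESNormFDerivOfEqConst ℝ
    (volume : Measure (EuclideanSpace ℝ (Fin N))) (2 : ℝ≥0)
  refine ⟨(C : ℝ) ^ critExp N 0, by positivity, ?_⟩
  rintro p ⟨φ, hφ, h1, h2⟩
  have hS := eLpNorm_le_eLpNorm_fderiv_of_eq (volume : Measure (EuclideanSpace ℝ (Fin N)))
    (hφ.1.of_le (by simp)) hφ.2.1 (p := 2) (p' := r) (by norm_num)
    (by rw [finrank_euclideanSpace_fin]; have := Ω.three_le; omega)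
    (by
      rw [finrank_euclideanSpace_fin, hrr]
      unfold critExp
      have : (N : ℝ) - 2 ≠ 0 := by linarith
      have : (N : ℝ) ≠ 0 := by linarith
      push_cast
      rw [sub_zero]
      field_simp)
  rw [ENNReal.coe_ofNat, eLpNorm_fderiv_eq_of_mem_testPairs hφ h2,
    eLpNorm_nnreal_eq_lintegral hr0] at hS
  have hS' := ENNReal.rpow_le_rpow hS hr.le
  rw [← ENNReal.rpow_mul, ← hrr, one_div, inv_mul_cancel₀ (by exact_mod_cast hr0),
    ENNReal.rpow_one, ← ENNReal.ofReal_coe_nnreal, ← ENNReal.ofReal_mul (by positivity),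
    ENNReal.ofReal_rpow_of_nonneg (by positivity) (by positivity),
    Real.mul_rpow (by positivity) (by positivity)] at hS'
  calc ∫⁻ x in Ω.carrier, ENNReal.ofReal (1 * |p.1 x| ^ critExp N 0)
      = ∫⁻ x in Ω.carrier, ‖φ x‖ₑ ^ (r : ℝ) := by
        refine lintegral_congr_ae ?_
        filter_upwards [h1] with x hx
        rw [hx, one_mul, ← hrr, ← Real.norm_eq_abs,
          ← ofReal_norm,
          ENNReal.ofReal_rpow_of_nonneg (norm_nonneg _) r.coe_nonneg]
    _ ≤ ∫⁻ x, ‖φ x‖ₑ ^ (r : ℝ) := setLIntegral_le_lintegral _ _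
    _ ≤ _ := hS'

/-! ### Weighted integral bounds on `H^1_0(Ω)` -/

lemma H10.exists_seq_testPairs (u : H10 Ω) : ∃ p : ℕ → L2Pair Ω.carrier,
    (∀ k, p k ∈ testPairs Ω.carrier) ∧ Tendsto p atTop (𝓝 (H10.toPair u)) ∧
    ∀ᵐ x ∂(volume.restrict Ω.carrier), Tendsto (fun k => (p k).1 x) atTop (𝓝 (u x)) := by
  obtain ⟨p, hp, hlim⟩ := mem_closure_iff_seq_limit.mp
    (show H10.toPair u ∈ closure (testPairs Ω.carrier : Set (L2Pair Ω.carrier)) from u.2)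
  obtain ⟨ns, hns, hae⟩ := (tendstoInMeasure_of_tendsto_Lp
    ((continuous_fst.tendsto _).comp hlim)).exists_seq_tendsto_ae
  exact ⟨p ∘ ns, fun k => hp _, hlim.comp hns.tendsto_atTop, hae⟩

/-- By Fatou's lemma, a bound of `∫ w |φ|^s` by the gradient norm passes from test functions to
all of `H^1_0(Ω)`. -/
lemma lintegral_le_of_test {w : EuclideanSpace ℝ (Fin N) → ℝ} (hw : Measurable w) {s C : ℝ}
    (hs : 0 ≤ s)
    (h : ∀ p ∈ testPairs Ω.carrier, ∫⁻ x in Ω.carrier, ENNReal.ofReal (w x * |p.1 x| ^ s) ≤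
      ENNReal.ofReal (C * ‖p.2‖ ^ s)) (u : H10 Ω) :
    ∫⁻ x in Ω.carrier, ENNReal.ofReal (w x * |u x| ^ s) ≤ ENNReal.ofReal (C * ‖u‖ ^ s) := by
  obtain ⟨p, hp, hlim, hae⟩ := u.exists_seq_testPairs
  have hnorm : Tendsto (fun k => ENNReal.ofReal (C * ‖(p k).2‖ ^ s)) atTop
      (𝓝 (ENNReal.ofReal (C * ‖u‖ ^ s))) := by
    have h1 : Tendsto (fun k => ‖(p k).2‖) atTop (𝓝 ‖u‖) := by
      rw [H10.norm_eq]
      exact ((continuous_snd.tendsto _).comp hlim).norm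
    exact ENNReal.tendsto_ofReal ((h1.rpow_const (Or.inr hs)).const_mul C)
  calc ∫⁻ x in Ω.carrier, ENNReal.ofReal (w x * |u x| ^ s)
      = ∫⁻ x in Ω.carrier, liminf (fun k => ENNReal.ofReal (w x * |(p k).1 x| ^ s)) atTop := by
        refine lintegral_congr_ae ?_
        filter_upwards [hae] with x hx
        exact (ENNReal.tendsto_ofReal
          ((hx.abs.rpow_const (Or.inr hs)).const_mul (w x))).liminf_eq.symm
    _ ≤ liminf (fun k => ∫⁻ x in Ω.carrier, ENNReal.ofReal (w x * |(p k).1 x| ^ s)) atTop := by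
        refine lintegral_liminf_le' fun k => ?_
        have := (Lp.aestronglyMeasurable (p k).1).aemeasurable
        fun_prop
    _ ≤ liminf (fun k => ENNReal.ofReal (C * ‖(p k).2‖ ^ s)) atTop :=
        liminf_le_liminf (Eventually.of_forall fun k => h _ (hp k))
    _ = _ := hnorm.liminf_eq

/-- `W` is an admissible weight for the exponent `p`, with constant `C`: it is nonnegative on `Ω`,
and `∫_Ω W |u|^p` is finite and at most `C ‖u‖^p` for all `u ∈ H^1_0(Ω)`. -/
structure IsWeight (Ω : BoundedDomain N) (W : EuclideanSpace ℝ (Fin N) → ℝ) (p C : ℝ) : Prop where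
  nonneg : ∀ᵐ x ∂(volume.restrict Ω.carrier), 0 ≤ W x
  aemeasurable : AEMeasurable W (volume.restrict Ω.carrier)
  integrable : ∀ u : H10 Ω, IntegrableOn (fun x => W x * |u x| ^ p) Ω.carrier
  bound : ∀ u : H10 Ω, ∫ x in Ω.carrier, W x * |u x| ^ p ≤ C * ‖u‖ ^ p

lemma H10.aemeasurable (u : H10 Ω) : AEMeasurable u (volume.restrict Ω.carrier) :=
  (Lp.aestronglyMeasurable u.val).aemeasurable

/-- A version of `IsWeight` with lower integrals implies `IsWeight`. -/
lemma IsWeight.of_lintegral {W : EuclideanSpace ℝ (Fin N) → ℝ} {p C : ℝ} (hC : 0 ≤ C)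
    (hW : ∀ x, 0 ≤ W x) (hm : Measurable W)
    (h : ∀ u : H10 Ω, ∫⁻ x in Ω.carrier, ENNReal.ofReal (W x * |u x| ^ p) ≤
      ENNReal.ofReal (C * ‖u‖ ^ p)) : IsWeight Ω W p C := by
  have hnn (u : H10 Ω) (x) : 0 ≤ W x * |u x| ^ p :=
    mul_nonneg (hW x) (Real.rpow_nonneg (abs_nonneg _) _)
  have hmeas (u : H10 Ω) : AEStronglyMeasurable (fun x => W x * |u x| ^ p)
      (volume.restrict Ω.carrier) := by
    have := u.aemeasurable
    exact AEMeasurable.aestronglyMeasurable (by fun_prop)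
  refine ⟨Eventually.of_forall hW, hm.aemeasurable, fun u => ⟨hmeas u, ?_⟩, fun u => ?_⟩
  · rw [hasFiniteIntegral_iff_ofReal (Eventually.of_forall (hnn u))]
    exact (h u).trans_lt ENNReal.ofReal_lt_top
  · rw [integral_eq_lintegral_of_nonneg_ae (Eventually.of_forall (hnn u)) (hmeas u)]
    exact ENNReal.toReal_le_of_le_ofReal (by positivity) (h u)

lemma rpow_le_rpow_add_rpow {y a q b : ℝ} (hy : 0 < y) (h1 : a ≤ q) (h2 : q ≤ b) :
    y ^ q ≤ y ^ a + y ^ b := by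
  rcases le_total y 1 with h | h
  · exact (Real.rpow_le_rpow_of_exponent_ge hy h h1).trans
      (le_add_of_nonneg_right (Real.rpow_nonneg hy.le _))
  · exact (Real.rpow_le_rpow_of_exponent_le h h2).trans
      (le_add_of_nonneg_left (Real.rpow_nonneg hy.le _))

/-- The pointwise inequality which reduces the Hardy–Sobolev inequality, for all exponents
`p ∈ [2, 2^*(t)]` at once, to the inequalities of Hardy, Poincaré and Sobolev. -/
lemma rpow_div_rpow_le (hN : 3 ≤ N) {t p y d : ℝ} (ht0 : 0 ≤ t) (ht2 : t < 2) (hp2 : 2 ≤ p)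
    (hp : p ≤ critExp N t) (hy : 0 ≤ y) (hd : 0 ≤ d) :
    1 / d ^ t * y ^ p ≤
      (d ^ 2)⁻¹ * y ^ (2 : ℝ) + 1 * y ^ (2 : ℝ) + 1 * y ^ critExp N 0 := by
  have hN' : (3 : ℝ) ≤ N := by exact_mod_cast hN
  rcases hy.eq_or_lt with rfl | hy
  · rw [Real.zero_rpow (by linarith : p ≠ 0), mul_zero]
    positivity
  set q := (p - t) / (1 - t / 2) with hq
  have h1t : 0 < 1 - t / 2 := by linarith
  have hq1 : 2 ≤ q := by rw [hq, le_div_iff₀ h1t]; linarith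
  have hq2 : q ≤ critExp N 0 := by
    rw [hq, div_le_iff₀ h1t]
    have : critExp N 0 * (1 - t / 2) = critExp N t - t := by
      unfold critExp
      have : (N : ℝ) - 2 ≠ 0 := by linarith
      field_simp
      ring
    linarith
  have hyoung := Real.geom_mean_le_arith_mean2_weighted (w₁ := t / 2) (w₂ := 1 - t / 2)
    (p₁ := (d⁻¹ * y) ^ 2) (p₂ := y ^ q) (by linarith) h1t.le (by positivity) (by positivity)
    (by ring)
  have hL : 1 / d ^ t * y ^ p = ((d⁻¹ * y) ^ 2) ^ (t / 2) * (y ^ q) ^ (1 - t / 2) := by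
    rw [← Real.rpow_mul hy.le, hq, div_mul_cancel₀ _ h1t.ne', ← Real.rpow_natCast,
      ← Real.rpow_mul (by positivity), one_div, ← Real.inv_rpow hd,
      show ((2 : ℕ) : ℝ) * (t / 2) = t by push_cast; ring,
      Real.mul_rpow (by positivity) hy.le, mul_assoc, ← Real.rpow_add hy]
    congr 2; ring
  rw [hL]
  refine hyoung.trans ?_
  have h3 := rpow_le_rpow_add_rpow hy hq1 hq2
  have h4 : (d⁻¹ * y) ^ 2 = (d ^ 2)⁻¹ * y ^ (2 : ℝ) := by
    rw [Real.rpow_two, mul_pow, inv_pow]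
  have h5 : t / 2 * (d⁻¹ * y) ^ 2 ≤ (d⁻¹ * y) ^ 2 :=
    mul_le_of_le_one_left (by positivity) (by linarith)
  have h6 : (1 - t / 2) * y ^ q ≤ y ^ q := mul_le_of_le_one_left (by positivity) (by linarith)
  linarith

lemma H10.coeFn_zero : (0 : H10 Ω) =ᵐ[volume.restrict Ω.carrier] (fun _ => (0 : ℝ)) := by
  have : (0 : H10 Ω).val = 0 := by simp [H10.val]
  change ((0 : H10 Ω).val : _ → ℝ) =ᵐ[volume.restrict Ω.carrier] fun _ => (0 : ℝ)
  rw [this]; exact Lp.coeFn_zero _ _ _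

lemma H10.coeFn_add (u v : H10 Ω) :
    (u + v : H10 Ω) =ᵐ[volume.restrict Ω.carrier] fun x => u x + v x := by
  have : (u + v).val = u.val + v.val := by simp [H10.val]
  change ((u + v).val : _ → ℝ) =ᵐ[volume.restrict Ω.carrier] _
  rw [this]; exact Lp.coeFn_add _ _

lemma H10.coeFn_sub (u v : H10 Ω) :
    (u - v : H10 Ω) =ᵐ[volume.restrict Ω.carrier] fun x => u x - v x := by
  have : (u - v).val = u.val - v.val := by simp [H10.val]
  change ((u - v).val : _ → ℝ) =ᵐ[volume.restrict Ω.carrier] _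
  rw [this]; exact Lp.coeFn_sub _ _

lemma H10.coeFn_smul (c : ℝ) (u : H10 Ω) :
    (c • u : H10 Ω) =ᵐ[volume.restrict Ω.carrier] fun x => c * u x := by
  have : (c • u).val = c • u.val := by simp [H10.val]
  change ((c • u).val : _ → ℝ) =ᵐ[volume.restrict Ω.carrier] _
  rw [this]; exact Lp.coeFn_smul _ _

lemma H10.coeFn_neg (u : H10 Ω) :
    (-u : H10 Ω) =ᵐ[volume.restrict Ω.carrier] fun x => -u x := by
  have : (-u).val = -u.val := by simp [H10.val]
  change ((-u).val : _ → ℝ) =ᵐ[volume.restrict Ω.carrier] _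
  rw [this]; exact Lp.coeFn_neg _

/-- **Hardy–Sobolev inequality** on `H^1_0(Ω)`, with one constant for all exponents in
`[2, 2^*(t)]`. -/
lemma exists_isWeight (Ω : BoundedDomain N) {t : ℝ} (ht0 : 0 ≤ t) (ht2 : t < 2) :
    ∃ C, 0 ≤ C ∧ ∀ p, 2 ≤ p → p ≤ critExp N t → IsWeight Ω (fun x => 1 / ‖x‖ ^ t) p C := by
  have hN : (3 : ℝ) ≤ N := by exact_mod_cast Ω.three_le
  have hr : 0 < critExp N 0 := by
    unfold critExp
    exact div_pos (by linarith) (by linarith)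
  obtain ⟨CP, hCP, hP⟩ := poincare_lintegral_test Ω
  obtain ⟨CS, hCS, hS⟩ := sobolev_test Ω
  have hH' := lintegral_le_of_test (Ω := Ω) (w := fun x => (‖x‖ ^ 2)⁻¹) (by fun_prop)
    zero_le_two fun p hp => hardy_test hp
  have hP' := lintegral_le_of_test (w := fun _ => 1) (by fun_prop) zero_le_two hP
  have hS' := lintegral_le_of_test (w := fun _ => 1) (by fun_prop) hr.le hS
  refine ⟨4 + CP + CS, by positivity, fun p hp2 hp => ?_⟩
  refine IsWeight.of_lintegral (by positivity) (fun x => by positivity)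
    (by fun_prop) fun u => ?_
  rcases eq_or_ne u 0 with rfl | hu
  · rw [lintegral_congr_ae (g := 0)]
    · simp
    · filter_upwards [H10.coeFn_zero (Ω := Ω)] with x hx
      rw [hx]
      simp [Real.zero_rpow (by linarith : p ≠ 0)]
  set v : H10 Ω := ‖u‖⁻¹ • u with hv
  have hnu : 0 < ‖u‖ := norm_pos_iff.mpr hu
  have hnv : ‖v‖ = 1 := by rw [hv, norm_smul, norm_inv, norm_norm, inv_mul_cancel₀ hnu.ne']
  have hv1 : ∫⁻ x in Ω.carrier, ENNReal.ofReal (1 / ‖x‖ ^ t * |v x| ^ p) ≤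
      ENNReal.ofReal (4 + CP + CS) := by
    have h1 := hH' v
    have h2 := hP' v
    have h3 := hS' v
    rw [hnv, Real.one_rpow, mul_one] at h1 h2 h3
    have hvm := v.aemeasurable
    calc ∫⁻ x in Ω.carrier, ENNReal.ofReal (1 / ‖x‖ ^ t * |v x| ^ p)
        ≤ ∫⁻ x in Ω.carrier, (ENNReal.ofReal ((‖x‖ ^ 2)⁻¹ * |v x| ^ (2 : ℝ)) +
            ENNReal.ofReal (1 * |v x| ^ (2 : ℝ)) + ENNReal.ofReal (1 * |v x| ^ critExp N 0)) := by
          refine lintegral_mono fun x => ?_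
          rw [← ENNReal.ofReal_add (by positivity) (by positivity),
            ← ENNReal.ofReal_add (by positivity) (by positivity)]
          exact ENNReal.ofReal_le_ofReal
            (rpow_div_rpow_le Ω.three_le ht0 ht2 hp2 hp (abs_nonneg _) (norm_nonneg _))
      _ ≤ ENNReal.ofReal 4 + ENNReal.ofReal CP + ENNReal.ofReal CS := by
          rw [lintegral_add_left' (by fun_prop), lintegral_add_left' (by fun_prop)]
          gcongr
      _ = _ := by
          rw [← ENNReal.ofReal_add (by positivity) (by positivity),
            ← ENNReal.ofReal_add (by positivity) (by positivity)]
  calc ∫⁻ x in Ω.carrier, ENNReal.ofReal (1 / ‖x‖ ^ t * |u x| ^ p)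
      = ∫⁻ x in Ω.carrier, ENNReal.ofReal (‖u‖ ^ p) *
          ENNReal.ofReal (1 / ‖x‖ ^ t * |v x| ^ p) := by
        refine lintegral_congr_ae ?_
        filter_upwards [H10.coeFn_smul ‖u‖⁻¹ u] with x hx
        rw [← ENNReal.ofReal_mul (by positivity), hv, hx, abs_mul, abs_inv, abs_norm,
          Real.mul_rpow (by positivity) (abs_nonneg _), Real.inv_rpow hnu.le]
        congr 1
        have : ‖u‖ ^ p ≠ 0 := (Real.rpow_pos_of_pos hnu p).ne'
        field_simp
    _ = ENNReal.ofReal (‖u‖ ^ p) *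
          ∫⁻ x in Ω.carrier, ENNReal.ofReal (1 / ‖x‖ ^ t * |v x| ^ p) :=
        lintegral_const_mul' _ _ ENNReal.ofReal_ne_top
    _ ≤ ENNReal.ofReal (‖u‖ ^ p) * ENNReal.ofReal (4 + CP + CS) := by gcongr
    _ = _ := by rw [← ENNReal.ofReal_mul (by positivity), mul_comm]

/-! ### Differentiability of `u ↦ ∫ W |u|^p` -/

lemma hasDerivAt_abs_rpow_mul_self {s : ℝ} (hs : 0 ≤ s) (y : ℝ) :
    HasDerivAt (fun y : ℝ => |y| ^ s * y) ((s + 1) * |y| ^ s) y := by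
  rcases hs.eq_or_lt with rfl | hs
  · simpa using hasDerivAt_id' y
  rcases eq_or_ne y 0 with rfl | hy
  · rw [hasDerivAt_iff_tendsto_slope]
    have h : Tendsto (fun y : ℝ => |y| ^ s) (𝓝[≠] 0) (𝓝 ((s + 1) * |0| ^ s)) := by
      have : Continuous fun y : ℝ => |y| ^ s := continuous_abs.rpow_const fun _ => Or.inr hs.le
      have h0 := this.tendsto 0
      simp only [abs_zero, Real.zero_rpow hs.ne', mul_zero] at h0 ⊢
      exact h0.mono_left nhdsWithin_le_nhds
    refine h.congr' ?_
    filter_upwards [self_mem_nhdsWithin] with y hy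
    have hy' : y ≠ 0 := hy
    simp [slope_def_field, hy']
  · have hy' : |y| ≠ 0 := abs_ne_zero.mpr hy
    have h := ((hasDerivAt_abs hy).rpow_const (p := s) (Or.inl hy')).mul (hasDerivAt_id' y)
    refine h.congr_deriv ?_
    rw [Real.rpow_sub_one hy', mul_one]
    have : (SignType.sign y : ℝ) * y = |y| := sign_mul_self y
    field_simp
    linear_combination s * this

/-- Second order Taylor estimate for `|x|^p`, `p ≥ 2`. -/
lemma abs_rpow_taylor {p : ℝ} (hp : 2 ≤ p) (x h : ℝ) :
    |(|x + h| ^ p - |x| ^ p - p * (|x| ^ (p - 2) * x * h))| ≤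
      p * (p - 1) * 2 ^ (p - 2) * (|x| ^ (p - 2) * |h| ^ (2 : ℝ) + |h| ^ p) := by
  have hs : 0 ≤ p - 2 := by linarith
  set R := |x| + |h| with hR
  have hball {y : ℝ} (hy : y ∈ Metric.closedBall x |h|) : |y| ≤ R := by
    rw [Metric.mem_closedBall, Real.dist_eq] at hy
    have := abs_add_le x (y - x)
    rw [add_sub_cancel] at this
    linarith
  have hx : x ∈ Metric.closedBall x |h| := Metric.mem_closedBall_self (abs_nonneg h)
  have hxh : x + h ∈ Metric.closedBall x |h| := by simp [Metric.mem_closedBall]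
  have hg {y : ℝ} (hy : y ∈ Metric.closedBall x |h|) :
      |(|y| ^ (p - 2) * y - |x| ^ (p - 2) * x)| ≤ (p - 1) * R ^ (p - 2) * |h| := by
    have h1 := Convex.norm_image_sub_le_of_norm_hasDerivWithin_le (C := (p - 1) * R ^ (p - 2))
      (fun z _ => (hasDerivAt_abs_rpow_mul_self hs z).hasDerivWithinAt)
      (fun z hz => ?_) (convex_closedBall x |h|) hx hy
    · refine h1.trans ?_
      have : 0 ≤ (p - 1) * R ^ (p - 2) := mul_nonneg (by linarith) (by positivity)
      rw [Metric.mem_closedBall, Real.dist_eq] at hy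
      gcongr
      exact hy
    · rw [Real.norm_eq_abs, abs_of_nonneg (by positivity)]
      rw [show p - 2 + 1 = p - 1 by ring]
      gcongr
      · linarith
      · exact hball hz
  have hF := Convex.norm_image_sub_le_of_norm_hasDerivWithin_le
    (f := fun y => |y| ^ p - p * (|x| ^ (p - 2) * x * y))
    (C := p * ((p - 1) * R ^ (p - 2) * |h|))
    (fun z _ => ((hasDerivAt_abs_rpow z (by linarith)).sub
      (((hasDerivAt_id' z).const_mul (|x| ^ (p - 2) * x)).const_mul p)).hasDerivWithinAt)
    (fun z hz => ?_) (convex_closedBall x |h|) hx hxh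
  · have hRle : R ^ (p - 2) ≤ 2 ^ (p - 2) * (|x| ^ (p - 2) + |h| ^ (p - 2)) := by
      have hmax : R ≤ 2 * max |x| |h| := by
        rw [hR]; linarith [le_max_left |x| |h|, le_max_right |x| |h|]
      calc R ^ (p - 2) ≤ (2 * max |x| |h|) ^ (p - 2) := by gcongr
        _ = 2 ^ (p - 2) * max |x| |h| ^ (p - 2) := Real.mul_rpow (by norm_num) (by positivity)
        _ ≤ _ := by
          gcongr
          rcases max_cases |x| |h| with ⟨h, -⟩ | ⟨h, -⟩ <;> rw [h]
          · exact le_add_of_nonneg_right (by positivity)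
          · exact le_add_of_nonneg_left (by positivity)
    have hpow : |h| ^ (p - 2) * |h| ^ (2 : ℝ) = |h| ^ p := by
      rw [← Real.rpow_add_of_nonneg (abs_nonneg _) hs (by norm_num)]; ring_nf
    calc |(|x + h| ^ p - |x| ^ p - p * (|x| ^ (p - 2) * x * h))|
        = ‖|x + h| ^ p - p * (|x| ^ (p - 2) * x * (x + h)) -
            (|x| ^ p - p * (|x| ^ (p - 2) * x * x))‖ := by
          rw [Real.norm_eq_abs]; congr 1; ring
      _ ≤ p * ((p - 1) * R ^ (p - 2) * |h|) * ‖x + h - x‖ := hF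
      _ = p * (p - 1) * R ^ (p - 2) * |h| ^ (2 : ℝ) := by
          rw [add_sub_cancel_left, Real.norm_eq_abs, Real.rpow_two]; ring
      _ ≤ p * (p - 1) * (2 ^ (p - 2) * (|x| ^ (p - 2) + |h| ^ (p - 2))) * |h| ^ (2 : ℝ) := by
          have : 0 ≤ p * (p - 1) := mul_nonneg (by linarith) (by linarith)
          gcongr
      _ = _ := by rw [← hpow]; ring
  · rw [Real.norm_eq_abs]
    have : p * |z| ^ (p - 2) * z - p * (|x| ^ (p - 2) * x * 1) =
        p * (|z| ^ (p - 2) * z - |x| ^ (p - 2) * x) := by ring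
    rw [this, abs_mul, abs_of_nonneg (by linarith : 0 ≤ p)]
    gcongr
    exact hg hz

/-- Young's inequality, in the form which is scaled to the sizes `α` of `x` and `β` of `y`. -/
lemma rpow_mul_le_scaled {p x y α β : ℝ} (hp : 1 ≤ p) (hx : 0 ≤ x) (hy : 0 ≤ y) (hα : 0 < α)
    (hβ : 0 < β) :
    x ^ (p - 1) * y ≤
      α ^ (p - 1) * β * ((1 - 1 / p) * (x ^ p / α ^ p) + 1 / p * (y ^ p / β ^ p)) := by
  have hp0 : 0 < p := by linarith
  have hy' := Real.geom_mean_le_arith_mean2_weighted (w₁ := 1 - 1 / p) (w₂ := 1 / p)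
    (p₁ := (x / α) ^ p) (p₂ := (y / β) ^ p)
    (by rw [sub_nonneg, div_le_one hp0]; exact hp) (by positivity) (by positivity)
    (by positivity) (by ring)
  rw [← Real.rpow_mul (by positivity), ← Real.rpow_mul (by positivity),
    show p * (1 - 1 / p) = p - 1 by field_simp, mul_one_div_cancel hp0.ne', Real.rpow_one,
    Real.div_rpow hx hα.le, Real.div_rpow hx hα.le, Real.div_rpow hy hβ.le] at hy'
  have hαp : 0 < α ^ (p - 1) := Real.rpow_pos_of_pos hα _
  calc x ^ (p - 1) * y = α ^ (p - 1) * β * (x ^ (p - 1) / α ^ (p - 1) * (y / β)) := by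
        field_simp
    _ ≤ _ := by gcongr

namespace IsWeight

variable {W : EuclideanSpace ℝ (Fin N) → ℝ} {p C : ℝ}

/-- Hölder's inequality with respect to an admissible weight: the constant is not enlarged. -/
lemma pairing_le (hW : IsWeight Ω W p C) (hp : 2 ≤ p) (m k : H10 Ω) :
    IntegrableOn (fun x => W x * (|m x| ^ (p - 1) * |k x|)) Ω.carrier ∧
    ∫ x in Ω.carrier, W x * (|m x| ^ (p - 1) * |k x|) ≤ C * ‖m‖ ^ (p - 1) * ‖k‖ := by
  have hp0 : 0 < p := by linarith
  have hp1 : p - 1 ≠ 0 := by linarith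
  have hzero (h : m = 0 ∨ k = 0) : (fun x => W x * (|m x| ^ (p - 1) * |k x|))
      =ᵐ[volume.restrict Ω.carrier] fun _ => (0 : ℝ) := by
    filter_upwards [H10.coeFn_zero (Ω := Ω)] with x hx
    rcases h with rfl | rfl <;> simp [hx, Real.zero_rpow hp1]
  have hzero' (h : m = 0 ∨ k = 0) : C * ‖m‖ ^ (p - 1) * ‖k‖ = 0 := by
    rcases h with rfl | rfl <;> simp [Real.zero_rpow hp1]
  by_cases h : m = 0 ∨ k = 0
  · refine ⟨(integrable_zero _ _ _).congr (hzero h).symm, ?_⟩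
    rw [hzero' h, integral_congr_ae (hzero h), integral_zero]
  · rw [not_or] at h
    have hα : 0 < ‖m‖ := norm_pos_iff.mpr h.1
    have hβ : 0 < ‖k‖ := norm_pos_iff.mpr h.2
    set A := ‖m‖ ^ (p - 1) * ‖k‖ with hA
    have hA0 : 0 ≤ A := by positivity
    have hi1 := (hW.integrable m).const_mul (A * (1 - 1 / p) / ‖m‖ ^ p)
    have hi2 := (hW.integrable k).const_mul (A * (1 / p) / ‖k‖ ^ p)
    have hle : ∀ᵐ x ∂(volume.restrict Ω.carrier), W x * (|m x| ^ (p - 1) * |k x|) ≤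
        A * (1 - 1 / p) / ‖m‖ ^ p * (W x * |m x| ^ p) +
          A * (1 / p) / ‖k‖ ^ p * (W x * |k x| ^ p) := by
      filter_upwards [hW.nonneg] with x hx
      refine (mul_le_mul_of_nonneg_left (rpow_mul_le_scaled (by linarith : 1 ≤ p) (abs_nonneg (m x))
        (abs_nonneg (k x)) hα hβ) hx).trans_eq ?_
      rw [hA]; ring
    have hnn : ∀ᵐ x ∂(volume.restrict Ω.carrier), 0 ≤ W x * (|m x| ^ (p - 1) * |k x|) := by
      filter_upwards [hW.nonneg] with x hx
      positivity
    have hint : IntegrableOn (fun x => W x * (|m x| ^ (p - 1) * |k x|)) Ω.carrier := by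
      refine Integrable.mono' (hi1.add hi2) ?_ ?_
      · have := hW.aemeasurable
        have := m.aemeasurable
        have := k.aemeasurable
        exact AEMeasurable.aestronglyMeasurable (by fun_prop)
      · filter_upwards [hle, hnn] with x h1 h2
        rw [Real.norm_eq_abs, abs_of_nonneg h2]
        exact h1
    refine ⟨hint, ?_⟩
    calc ∫ x in Ω.carrier, W x * (|m x| ^ (p - 1) * |k x|)
        ≤ ∫ x in Ω.carrier, (A * (1 - 1 / p) / ‖m‖ ^ p * (W x * |m x| ^ p) +
          A * (1 / p) / ‖k‖ ^ p * (W x * |k x| ^ p)) :=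
          integral_mono_ae hint (hi1.add hi2) hle
      _ = A * (1 - 1 / p) / ‖m‖ ^ p * (∫ x in Ω.carrier, W x * |m x| ^ p) +
          A * (1 / p) / ‖k‖ ^ p * ∫ x in Ω.carrier, W x * |k x| ^ p := by
          rw [integral_add hi1 hi2, integral_const_mul, integral_const_mul]
      _ ≤ A * (1 - 1 / p) / ‖m‖ ^ p * (C * ‖m‖ ^ p) + A * (1 / p) / ‖k‖ ^ p * (C * ‖k‖ ^ p) := by
          have h1 : 0 ≤ 1 - 1 / p := by rw [sub_nonneg, div_le_one hp0]; linarith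
          gcongr
          · exact hW.bound m
          · exact hW.bound k
      _ = C * ‖m‖ ^ (p - 1) * ‖k‖ := by
          rw [hA]
          have h1 : ‖m‖ ^ p ≠ 0 := (Real.rpow_pos_of_pos hα p).ne'
          have h2 : ‖k‖ ^ p ≠ 0 := (Real.rpow_pos_of_pos hβ p).ne'
          field_simp
          ring

lemma abs_pairing (hp : 2 ≤ p) (a b : ℝ) : |(|a| ^ (p - 2) * a * b)| = |a| ^ (p - 1) * |b| := by
  rw [abs_mul, abs_mul, abs_of_nonneg (Real.rpow_nonneg (abs_nonneg a) _)]
  congr 1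
  nth_rewrite 2 [← Real.rpow_one |a|]
  rw [← Real.rpow_add_of_nonneg (abs_nonneg a) (by linarith) (by norm_num)]
  congr 1; ring

lemma integrable_pairing (hW : IsWeight Ω W p C) (hp : 2 ≤ p) (u φ : H10 Ω) :
    IntegrableOn (fun x => W x * (|u x| ^ (p - 2) * u x * φ x)) Ω.carrier := by
  refine Integrable.mono' (hW.pairing_le hp u φ).1 ?_ ?_
  · have := hW.aemeasurable
    have := u.aemeasurable
    have := φ.aemeasurable
    exact AEMeasurable.aestronglyMeasurable (by fun_prop)
  · filter_upwards [hW.nonneg] with x hx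
    rw [Real.norm_eq_abs, abs_mul, abs_of_nonneg hx, abs_pairing hp]

/-- The functional `φ ↦ ∫ W |u|^(p-2) u φ` is represented by an element of `H^1_0(Ω)`. -/
lemma exists_riesz (hW : IsWeight Ω W p C) (hp : 2 ≤ p) (u : H10 Ω) :
    ∃ k : H10 Ω, ∀ φ : H10 Ω,
      inner ℝ k φ = ∫ x in Ω.carrier, W x * (|u x| ^ (p - 2) * u x * φ x) := by
  let L : H10 Ω →ₗ[ℝ] ℝ :=
    { toFun := fun φ => ∫ x in Ω.carrier, W x * (|u x| ^ (p - 2) * u x * φ x)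
      map_add' := fun φ ψ => by
        rw [← integral_add (hW.integrable_pairing hp u φ) (hW.integrable_pairing hp u ψ)]
        refine integral_congr_ae ?_
        filter_upwards [H10.coeFn_add φ ψ] with x hx
        rw [hx]; ring
      map_smul' := fun c φ => by
        rw [RingHom.id_apply, smul_eq_mul, ← integral_const_mul]
        refine integral_congr_ae ?_
        filter_upwards [H10.coeFn_smul c φ] with x hx
        rw [hx]; ring }
  have hL (φ : H10 Ω) : ‖L φ‖ ≤ C * ‖u‖ ^ (p - 1) * ‖φ‖ := by
    refine (norm_integral_le_integral_norm _).trans (le_trans (le_of_eq ?_)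
      (hW.pairing_le hp u φ).2)
    refine integral_congr_ae ?_
    filter_upwards [hW.nonneg] with x hx
    rw [Real.norm_eq_abs, abs_mul, abs_of_nonneg hx, abs_pairing hp]
  refine ⟨(InnerProductSpace.toDual ℝ (H10 Ω)).symm (L.mkContinuous _ hL), fun φ => ?_⟩
  rw [InnerProductSpace.toDual_symm_apply]
  rfl

/-- The Taylor remainder of `u ↦ ∫ W |u|^p` is quadratic. -/
lemma remainder_le (hW : IsWeight Ω W p C) (hp : 2 ≤ p) (u h : H10 Ω) (hh : ‖h‖ ≤ 1) :
    |(∫ x in Ω.carrier, W x * |(u + h) x| ^ p) - (∫ x in Ω.carrier, W x * |u x| ^ p) -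
      p * ∫ x in Ω.carrier, W x * (|u x| ^ (p - 2) * u x * h x)| ≤
    p * (p - 1) * 2 ^ (p - 2) * (C * ‖u‖ ^ p + 2 * C) * ‖h‖ ^ 2 := by
  have hp0 : 0 < p := by linarith
  rcases eq_or_ne h 0 with rfl | hne
  · have h0 : ∫ x in Ω.carrier, W x * (|u x| ^ (p - 2) * u x * (0 : H10 Ω) x) = 0 := by
      rw [integral_congr_ae (g := fun x => (0 : ℝ)) (by
        filter_upwards [H10.coeFn_zero (Ω := Ω)] with x hx
        rw [hx]; simp), integral_zero]
    rw [h0]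
    simp
  have hβ : 0 < ‖h‖ := norm_pos_iff.mpr hne
  set M := p * (p - 1) * 2 ^ (p - 2) with hM
  have hM0 : 0 ≤ M := by
    have : 0 ≤ p * (p - 1) := mul_nonneg (by linarith) (by linarith)
    positivity
  have hC : 0 ≤ C := by
    have h1 : 0 ≤ C * ‖h‖ ^ p := (integral_nonneg_of_ae (by
      filter_upwards [hW.nonneg] with x hx
      simp only [Pi.zero_apply]
      positivity)).trans (hW.bound h)
    exact nonneg_of_mul_nonneg_left h1 (Real.rpow_pos_of_pos hβ p)
  have hiu := hW.integrable u
  have hih := hW.integrable h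
  have hiuh := hW.integrable (u + h)
  have hip := hW.integrable_pairing hp u h
  have hsub : IntegrableOn (fun x => W x * |(u + h) x| ^ p - W x * |u x| ^ p) Ω.carrier :=
    hiuh.sub hiu
  rw [← integral_const_mul, ← integral_sub hiuh hiu,
    ← integral_sub (hf := hsub) (hg := hip.const_mul p)]
  have hpow : ‖h‖ ^ p ≤ ‖h‖ ^ 2 := by
    rw [← Real.rpow_two]
    exact Real.rpow_le_rpow_of_exponent_ge hβ hh hp
  have hpt : ∀ᵐ x ∂(volume.restrict Ω.carrier),
      ‖W x * |(u + h) x| ^ p - W x * |u x| ^ p - p * (W x * (|u x| ^ (p - 2) * u x * h x))‖ ≤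
      M * ‖h‖ ^ 2 * (W x * |u x| ^ p) +
        M * (‖h‖ ^ 2 / ‖h‖ ^ p + 1) * (W x * |h x| ^ p) := by
    filter_upwards [hW.nonneg, H10.coeFn_add u h] with x hx hadd
    rw [hadd, show W x * |u x + h x| ^ p - W x * |u x| ^ p -
        p * (W x * (|u x| ^ (p - 2) * u x * h x)) =
        W x * (|u x + h x| ^ p - |u x| ^ p - p * (|u x| ^ (p - 2) * u x * h x)) by ring,
      Real.norm_eq_abs, abs_mul, abs_of_nonneg hx]
    have h1 := abs_rpow_taylor hp (u x) (h x)
    have h2 : |u x| ^ (p - 2) * |h x| ^ (2 : ℝ) ≤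
        ‖h‖ ^ 2 * (|u x| ^ p + |h x| ^ p / ‖h‖ ^ p) := by
      set y := |h x| / ‖h‖ with hy
      have hy0 : 0 ≤ y := by positivity
      have hhx : |h x| = ‖h‖ * y := by rw [hy]; field_simp
      have h3 : |u x| ^ (p - 2) * y ^ (2 : ℝ) ≤ |u x| ^ p + y ^ p := by
        rcases le_total |u x| y with hle | hle
        · calc |u x| ^ (p - 2) * y ^ (2 : ℝ) ≤ y ^ (p - 2) * y ^ (2 : ℝ) := by
                gcongr
            _ = y ^ p := by
                rw [← Real.rpow_add_of_nonneg hy0 (by linarith) (by norm_num)]; ring_nf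
            _ ≤ _ := le_add_of_nonneg_left (by positivity)
        · calc |u x| ^ (p - 2) * y ^ (2 : ℝ) ≤ |u x| ^ (p - 2) * |u x| ^ (2 : ℝ) := by gcongr
            _ = |u x| ^ p := by
                rw [← Real.rpow_add_of_nonneg (abs_nonneg _) (by linarith) (by norm_num)]
                ring_nf
            _ ≤ _ := le_add_of_nonneg_right (by positivity)
      calc |u x| ^ (p - 2) * |h x| ^ (2 : ℝ)
          = ‖h‖ ^ 2 * (|u x| ^ (p - 2) * y ^ (2 : ℝ)) := by
            rw [hhx, Real.mul_rpow hβ.le hy0, Real.rpow_two ‖h‖]; ring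
        _ ≤ ‖h‖ ^ 2 * (|u x| ^ p + y ^ p) := by gcongr
        _ = _ := by rw [hy, Real.div_rpow (abs_nonneg _) hβ.le]
    calc W x * |(|u x + h x| ^ p - |u x| ^ p - p * (|u x| ^ (p - 2) * u x * h x))|
        ≤ W x * (M * (‖h‖ ^ 2 * (|u x| ^ p + |h x| ^ p / ‖h‖ ^ p) + |h x| ^ p)) := by
          gcongr
          exact h1.trans (by gcongr)
      _ = _ := by ring
  have hb : ∫ x in Ω.carrier, (M * ‖h‖ ^ 2 * (W x * |u x| ^ p) +
      M * (‖h‖ ^ 2 / ‖h‖ ^ p + 1) * (W x * |h x| ^ p)) ≤ M * (C * ‖u‖ ^ p + 2 * C) * ‖h‖ ^ 2 := by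
    rw [integral_add (hiu.const_mul _) (hih.const_mul _), integral_const_mul, integral_const_mul]
    calc _ ≤ M * ‖h‖ ^ 2 * (C * ‖u‖ ^ p) +
          M * (‖h‖ ^ 2 / ‖h‖ ^ p + 1) * (C * ‖h‖ ^ p) := by
          gcongr
          · exact hW.bound u
          · exact hW.bound h
      _ = M * (C * ‖u‖ ^ p * ‖h‖ ^ 2 + C * (‖h‖ ^ 2 + ‖h‖ ^ p)) := by
          have h2 : ‖h‖ ^ p ≠ 0 := (Real.rpow_pos_of_pos hβ p).ne'
          field_simp
      _ ≤ M * (C * ‖u‖ ^ p * ‖h‖ ^ 2 + C * (‖h‖ ^ 2 + ‖h‖ ^ 2)) := by gcongr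
      _ = _ := by ring
  exact (norm_integral_le_of_norm_le ((hiu.const_mul _).add (hih.const_mul _)) hpt).trans hb

/-- `u ↦ ∫ W |u|^p` is differentiable, and its gradient `p • k` at `u` represents the functional
`φ ↦ p ∫ W |u|^(p-2) u φ`. -/
lemma exists_hasGradientAt (hW : IsWeight Ω W p C) (hp : 2 ≤ p) (u : H10 Ω) :
    ∃ k : H10 Ω, (∀ φ : H10 Ω,
      inner ℝ k φ = ∫ x in Ω.carrier, W x * (|u x| ^ (p - 2) * u x * φ x)) ∧
    HasGradientAt (fun v : H10 Ω => ∫ x in Ω.carrier, W x * |v x| ^ p) (p • k) u := by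
  obtain ⟨k, hk⟩ := hW.exists_riesz hp u
  refine ⟨k, hk, ?_⟩
  rw [hasGradientAt_iff_isLittleO_nhds_zero]
  refine Asymptotics.IsBigO.trans_isLittleO (g := fun h : H10 Ω => ‖h‖ ^ 2) ?_ ?_
  · refine Asymptotics.IsBigO.of_bound
      (p * (p - 1) * 2 ^ (p - 2) * (C * ‖u‖ ^ p + 2 * C)) ?_
    filter_upwards [Metric.closedBall_mem_nhds (0 : H10 Ω) one_pos] with h hh
    rw [mem_closedBall_zero_iff] at hh
    rw [real_inner_smul_left, hk, norm_pow, norm_norm]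
    exact hW.remainder_le hp u h hh
  · simpa using (Asymptotics.isLittleO_norm_pow_id (E' := H10 Ω) one_lt_two)

end IsWeight

/-! ### The absolute value on `H^1_0(Ω)` -/

/-- A sequence in a Hilbert space with norms bounded by a convergent sequence has a weak cluster
point, whose norm is at most the limit of the bounds. Each continuous linear map that takes the
sequence to a convergent sequence takes the cluster point to its limit. -/
lemma exists_weak_clusterPt {H F : Type*} [NormedAddCommGroup H] [InnerProductSpace ℝ H]
    [CompleteSpace H] [NormedAddCommGroup F] [InnerProductSpace ℝ F] [CompleteSpace F]
    (T : H →L[ℝ] F) {w : ℕ → H} {R : ℕ → ℝ} {r : ℝ} (hw : ∀ k, ‖w k‖ ≤ R k)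
    (hR : Tendsto R atTop (𝓝 r)) {y : F} (hy : Tendsto (fun k => T (w k)) atTop (𝓝 y)) :
    ∃ z : H, ‖z‖ ≤ r ∧ T z = y := by
  obtain ⟨B, hB⟩ := hR.bddAbove_range
  set K : Set (WeakDual ℝ H) :=
    WeakDual.toStrongDual ⁻¹' Metric.closedBall (0 : StrongDual ℝ H) B
  have hK : IsCompact K := WeakDual.isCompact_closedBall 0 B
  set f : ℕ → WeakDual ℝ H := fun k => StrongDual.toWeakDual (InnerProductSpace.toDual ℝ H (w k))
  have hf (k : ℕ) : f k ∈ K := by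
    change InnerProductSpace.toDual ℝ H (w k) ∈ Metric.closedBall (0 : StrongDual ℝ H) B
    rw [mem_closedBall_zero_iff, LinearIsometryEquiv.norm_map]
    exact (hw k).trans (hB ⟨k, rfl⟩)
  let U : Ultrafilter ℕ := hyperfilter ℕ
  have hU : (U : Filter ℕ) ≤ atTop := by
    rw [← Nat.cofinite_eq_atTop]; exact hyperfilter_le_cofinite
  obtain ⟨ℓ, -, hℓ⟩ := hK.ultrafilter_le_nhds (U.map f)
    (le_principal_iff.mpr (Filter.mem_map.mpr (Filter.univ_mem' hf)))
  set z : H := (InnerProductSpace.toDual ℝ H).symm (WeakDual.toStrongDual ℓ)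
  have hweak (g : H) : Tendsto (fun k => inner ℝ (w k) g) U (𝓝 (inner ℝ z g)) := by
    have h1 : Tendsto f U (𝓝 ℓ) := hℓ
    have h2 := ((WeakDual.eval_continuous g).tendsto ℓ).comp h1
    have h3 : inner ℝ z g = ℓ g := InnerProductSpace.toDual_symm_apply
    rw [h3]
    exact h2
  refine ⟨z, ?_, ?_⟩
  · have h1 := le_of_tendsto_of_tendsto' (hweak z)
      ((hR.mono_left hU).mul_const ‖z‖) fun k =>
        (real_inner_le_norm _ _).trans (mul_le_mul_of_nonneg_right (hw k) (norm_nonneg z))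
    rw [real_inner_self_eq_norm_mul_norm] at h1
    rcases (norm_nonneg z).eq_or_lt with h | h
    · rw [← h]
      exact ge_of_tendsto' hR fun k => (norm_nonneg _).trans (hw k)
    · exact le_of_mul_le_mul_right h1 h
  · refine ext_inner_right ℝ fun g => ?_
    have h1 := hweak (ContinuousLinearMap.adjoint T g)
    simp_rw [ContinuousLinearMap.adjoint_inner_right] at h1
    exact tendsto_nhds_unique h1 ((hy.mono_left hU).inner tendsto_const_nhds)

/-- The smooth approximation `√(φ² + η²) - η` of `|φ|` does not enlarge gradients. -/
lemma exists_smooth_abs {p : L2Pair Ω.carrier} (hp : p ∈ testPairs Ω.carrier) {η : ℝ}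
    (hη : 0 < η) : ∃ q ∈ testPairs Ω.carrier, ‖q.2‖ ≤ ‖p.2‖ ∧
      ∀ᵐ x ∂(volume.restrict Ω.carrier), |(q.1 x - |p.1 x|)| ≤ η := by
  obtain ⟨φ, ⟨hφ, hφc, hφs⟩, h1, h2⟩ := hp
  set G : ℝ → ℝ := fun y => √(y ^ 2 + η ^ 2) - η with hG
  have hpos (y : ℝ) : 0 < y ^ 2 + η ^ 2 := by positivity
  have hG0 : G 0 = 0 := by simp [hG, Real.sqrt_sq hη.le]
  have hGd (y : ℝ) : HasDerivAt G (y / √(y ^ 2 + η ^ 2)) y := by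
    have h := ((((hasDerivAt_id' y).pow 2).add_const (η ^ 2)).sqrt (hpos y).ne').sub_const η
    refine h.congr_deriv ?_
    simp
    field_simp
  have hGd' (y : ℝ) : |y / √(y ^ 2 + η ^ 2)| ≤ 1 := by
    rw [abs_div, abs_of_pos (Real.sqrt_pos.mpr (hpos y)),
      div_le_one (Real.sqrt_pos.mpr (hpos y))]
    exact Real.abs_le_sqrt (by nlinarith)
  have hGabs (y : ℝ) : |(G y - |y|)| ≤ η := by
    have h3 : |y| ≤ √(y ^ 2 + η ^ 2) := Real.abs_le_sqrt (by nlinarith)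
    have h4 : √(y ^ 2 + η ^ 2) ≤ |y| + η := by
      rw [Real.sqrt_le_left (by positivity)]
      nlinarith [sq_abs y, abs_nonneg y]
    rw [abs_le]
    constructor <;> simp only [hG] <;> linarith
  set ψ : EuclideanSpace ℝ (Fin N) → ℝ := G ∘ φ
  have hψ : ContDiff ℝ ∞ ψ := by
    refine ContDiff.sub (ContDiff.sqrt ((hφ.pow 2).add contDiff_const) fun x => ?_) contDiff_const
    exact (hpos _).ne'
  have hψc : HasCompactSupport ψ := hφc.comp_left hG0
  have hψs : tsupport ψ ⊆ Ω.carrier := (tsupport_comp_subset hG0 φ).trans hφs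
  have hgrad (x : EuclideanSpace ℝ (Fin N)) : ‖gradient ψ x‖ ≤ ‖gradient φ x‖ := by
    have h3 : fderiv ℝ ψ x = (φ x / √(φ x ^ 2 + η ^ 2)) • fderiv ℝ φ x :=
      ((hGd (φ x)).comp_hasFDerivAt x (hφ.differentiable (by simp) x).hasFDerivAt).fderiv
    simp only [gradient, LinearIsometryEquiv.norm_map]
    rw [h3, norm_smul]
    exact mul_le_of_le_one_left (norm_nonneg _) (hGd' _)
  have hψm : MemLp ψ 2 (volume.restrict Ω.carrier) :=
    hψ.continuous.memLp_of_hasCompactSupport hψc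
  have hgm : MemLp (gradient ψ) 2 (volume.restrict Ω.carrier) := by
    refine Continuous.memLp_of_hasCompactSupport ?_ ?_
    · exact (InnerProductSpace.toDual ℝ _).symm.continuous.comp (hψ.continuous_fderiv (by simp))
    · exact (hψc.fderiv ℝ).comp_left (map_zero (InnerProductSpace.toDual ℝ _).symm)
  refine ⟨(hψm.toLp ψ, hgm.toLp _), ⟨ψ, ⟨hψ, hψc, hψs⟩, hψm.coeFn_toLp, hgm.coeFn_toLp⟩, ?_, ?_⟩
  · refine Lp.norm_le_norm_of_ae_le ?_
    filter_upwards [hgm.coeFn_toLp, h2] with x hx hx2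
    rw [hx, hx2]
    exact hgrad x
  · filter_upwards [hψm.coeFn_toLp, h1] with x hx hx1
    rw [hx, hx1]
    exact hGabs (φ x)

namespace H10

/-- The map `u ↦ u` from `H^1_0(Ω)` to `L²(Ω)`, which is continuous by Poincaré's inequality. -/
lemma exists_valL (Ω : BoundedDomain N) :
    ∃ T : H10 Ω →L[ℝ] Lp ℝ 2 (volume.restrict Ω.carrier), ∀ u, T u = u.val := by
  obtain ⟨C, hC⟩ := poincare Ω
  exact ⟨((LinearMap.fst ℝ _ _).comp toPair).mkContinuous C fun u => by
    rw [norm_eq]; exact hC u, fun u => rfl⟩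

/-- `H^1_0(Ω)` is stable under the absolute value, which does not enlarge the norm. -/
lemma exists_abs (u : H10 Ω) : ∃ v : H10 Ω, ‖v‖ ≤ ‖u‖ ∧
    v =ᵐ[volume.restrict Ω.carrier] fun x => |u x| := by
  obtain ⟨p, hp, hlim, -⟩ := u.exists_seq_testPairs
  set η : ℕ → ℝ := fun k => 1 / ((k : ℝ) + 1)
  have hη0 (k : ℕ) : 0 < η k := by positivity
  have hη : Tendsto η atTop (𝓝 0) := tendsto_one_div_add_atTop_nhds_zero_nat
  choose q hq hqp hqη using fun k => exists_smooth_abs (hp k) (hη0 k)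
  let w : ℕ → H10 Ω := fun k => ⟨q k, subset_closure (hq k)⟩
  obtain ⟨T, hT⟩ := exists_valL Ω
  have hw (k : ℕ) : ‖w k‖ ≤ ‖(p k).2‖ := by rw [norm_eq]; exact hqp k
  have hR : Tendsto (fun k => ‖(p k).2‖) atTop (𝓝 ‖u‖) := by
    rw [norm_eq]; exact ((continuous_snd.tendsto _).comp hlim).norm
  have : IsFiniteMeasure (volume.restrict Ω.carrier) :=
    ⟨by rw [Measure.restrict_apply_univ]; exact Ω.isBounded.measure_lt_top⟩
  have hy : Tendsto (fun k => T (w k)) atTop (𝓝 |u.val|) := by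
    rw [tendsto_iff_norm_sub_tendsto_zero]
    have h1 : Tendsto (fun k => ‖(p k).1 - u.val‖) atTop (𝓝 0) :=
      tendsto_iff_norm_sub_tendsto_zero.mp ((continuous_fst.tendsto _).comp hlim)
    have h2 := (hη.const_mul
      ((measureUnivNNReal (volume.restrict Ω.carrier) : ℝ) ^ (2 : ℝ≥0∞).toReal⁻¹)).add h1
    rw [mul_zero, add_zero] at h2
    refine squeeze_zero (fun _ => norm_nonneg _) (fun k => ?_) h2
    have hTw : T (w k) = (q k).1 := hT (w k)
    rw [hTw]
    calc ‖(q k).1 - |u.val|‖ ≤ ‖(q k).1 - |(p k).1|‖ + ‖|(p k).1| - |u.val|‖ :=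
          norm_sub_le_norm_sub_add_norm_sub _ _ _
      _ ≤ _ := by
          refine add_le_add ?_ (norm_abs_sub_abs _ _)
          refine Lp.norm_le_of_ae_bound (hη0 k).le ?_
          filter_upwards [Lp.coeFn_sub (q k).1 |(p k).1|, Lp.coeFn_abs (p k).1, hqη k]
            with x hx1 hx2 hx3
          rw [hx1, Pi.sub_apply, hx2]
          exact hx3
  obtain ⟨z, hz, hTz⟩ := exists_weak_clusterPt T hw hR hy
  refine ⟨z, hz, ?_⟩
  rw [hT] at hTz
  change (z.val : _ → ℝ) =ᵐ[volume.restrict Ω.carrier] _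
  rw [hTz]
  exact Lp.coeFn_abs u.val

/-- The decomposition `u = u⁺ - u⁻` into a positive and a negative part. Their inner product is
nonpositive (in fact zero), since `|u|` has norm at most `‖u‖`. -/
lemma exists_posPart_negPart (u : H10 Ω) : ∃ up un : H10 Ω, up ∈ cone Ω ∧ un ∈ cone Ω ∧
    u = up - un ∧ ‖un‖ ^ 2 ≤ -inner ℝ u un := by
  obtain ⟨v, hv, hvu⟩ := u.exists_abs
  refine ⟨(2⁻¹ : ℝ) • (v + u), (2⁻¹ : ℝ) • (v - u), ?_, ?_, ?_, ?_⟩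
  · change ∀ᵐ x ∂_, _
    filter_upwards [coeFn_smul (2⁻¹ : ℝ) (v + u), coeFn_add v u, hvu] with x h1 h2 h3
    rw [h1, h2, h3]
    linarith [neg_abs_le (u x)]
  · change ∀ᵐ x ∂_, _
    filter_upwards [coeFn_smul (2⁻¹ : ℝ) (v - u), coeFn_sub v u, hvu] with x h1 h2 h3
    rw [h1, h2, h3]
    linarith [le_abs_self (u x)]
  · rw [← smul_sub, add_sub_sub_cancel, ← two_smul ℝ u, smul_smul]
    norm_num
  · rw [norm_smul, mul_pow, real_inner_smul_right, @norm_sub_sq_real, inner_sub_right,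
      real_inner_self_eq_norm_sq, real_inner_comm u v, Real.norm_eq_abs]
    have : ‖v‖ ^ 2 ≤ ‖u‖ ^ 2 := by gcongr
    rw [real_inner_comm]
    norm_num
    linarith

end H10

/-! ### The gradient of the energy functional -/

lemma H10.integral_norm_grad_sq (u : H10 Ω) : ∫ x in Ω.carrier, ‖u.grad x‖ ^ 2 = ‖u‖ ^ 2 := by
  rw [← real_inner_self_eq_norm_sq, H10.inner_eq, L2.inner_def]
  simp_rw [real_inner_self_eq_norm_sq]

/-- The form `∫_Ω W |u|^(p-2) u φ`. -/
noncomputable def pairing (W : EuclideanSpace ℝ (Fin N) → ℝ) (p : ℝ) (u φ : H10 Ω) : ℝ :=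
  ∫ x in Ω.carrier, W x * (|u x| ^ (p - 2) * u x * φ x)

lemma pairing_neg_left (W : EuclideanSpace ℝ (Fin N) → ℝ) (p : ℝ) (u φ : H10 Ω) :
    pairing W p (-u) φ = -pairing W p u φ := by
  rw [pairing, pairing, ← integral_neg]
  refine integral_congr_ae ?_
  filter_upwards [H10.coeFn_neg u] with x hx
  rw [hx, abs_neg]; ring

/-- Only the negative part of `u`, which is at most `|u - w|` for `w ≥ 0`, contributes to a lower
bound of the pairing with a nonnegative function. -/
lemma IsWeight.neg_pairing_le {W : EuclideanSpace ℝ (Fin N) → ℝ} {p C : ℝ}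
    (hW : IsWeight Ω W p C) (hp : 2 ≤ p) {u w k : H10 Ω} (hw : w ∈ cone Ω) (hk : k ∈ cone Ω) :
    -pairing W p u k ≤ C * ‖u - w‖ ^ (p - 1) * ‖k‖ := by
  obtain ⟨h1, h2⟩ := hW.pairing_le hp (u - w) k
  refine le_trans ?_ h2
  rw [pairing, ← integral_neg]
  refine integral_mono_ae (hW.integrable_pairing hp u k).neg h1 ?_
  filter_upwards [hW.nonneg, hw, hk, H10.coeFn_sub u w] with x hx hwx hkx hsub
  rw [hsub, abs_of_nonneg hkx, ← mul_neg, ← neg_mul]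
  refine mul_le_mul_of_nonneg_left (mul_le_mul_of_nonneg_right ?_ hkx) hx
  rcases le_total 0 (u x) with hu | hu
  · exact (neg_nonpos.mpr (by positivity)).trans (by positivity)
  · have h3 := IsWeight.abs_pairing hp (u x) 1
    rw [mul_one, abs_one, mul_one] at h3
    refine (neg_le_abs _).trans (h3.le.trans ?_)
    refine Real.rpow_le_rpow (abs_nonneg _) ?_ (by linarith)
    rw [abs_of_nonpos hu, abs_of_nonpos (by linarith)]
    linarith

/-- The three weights which occur in the energy functional are admissible, with constants `Ca`,
`C₀` and `Ct`, and both of its exponents are at least `2`. -/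
structure EnergyWeights (Ω : BoundedDomain N) (a : EuclideanSpace ℝ (Fin N) → ℝ)
    (t ε Ca C₀ Ct : ℝ) : Prop where
  linear : IsWeight Ω a 2 Ca
  pow : IsWeight Ω (fun x => 1 / ‖x‖ ^ (0 : ℝ)) (critExp N 0 - ε) C₀
  singular : IsWeight Ω (fun x => 1 / ‖x‖ ^ t) (critExp N t - ε) Ct
  linear_nonneg : 0 ≤ Ca
  pow_nonneg : 0 ≤ C₀
  singular_nonneg : 0 ≤ Ct
  two_le_pow : 2 ≤ critExp N 0 - ε
  two_le_singular : 2 ≤ critExp N t - ε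

namespace EnergyWeights

variable {a : EuclideanSpace ℝ (Fin N) → ℝ} {t ε Ca C₀ Ct : ℝ}

lemma exists_hasGradientAt_energy (h : EnergyWeights Ω a t ε Ca C₀ Ct) (μ : ℝ) (u : H10 Ω) :
    ∃ k : H10 Ω, HasGradientAt (energy Ω a μ t ε) (u - k) u ∧ ∀ φ : H10 Ω,
      inner ℝ k φ = pairing a 2 u φ
        + μ * pairing (fun x => 1 / ‖x‖ ^ (0 : ℝ)) (critExp N 0 - ε) u φ
        + pairing (fun x => 1 / ‖x‖ ^ t) (critExp N t - ε) u φ := by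
  obtain ⟨k₁, hk₁, hg₁⟩ := h.linear.exists_hasGradientAt le_rfl u
  obtain ⟨k₂, hk₂, hg₂⟩ := h.pow.exists_hasGradientAt h.two_le_pow u
  obtain ⟨k₃, hk₃, hg₃⟩ := h.singular.exists_hasGradientAt h.two_le_singular u
  refine ⟨k₁ + μ • k₂ + k₃, ?_, fun φ => ?_⟩
  · have hq : critExp N 0 - ε ≠ 0 := by linarith [h.two_le_pow]
    have hp : critExp N t - ε ≠ 0 := by linarith [h.two_le_singular]
    have hfun : energy Ω a μ t ε = fun v : H10 Ω => 1 / 2 * ‖v‖ ^ 2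
        - 1 / 2 * (∫ x in Ω.carrier, a x * |v x| ^ (2 : ℝ))
        - μ / (critExp N 0 - ε) *
          (∫ x in Ω.carrier, 1 / ‖x‖ ^ (0 : ℝ) * |v x| ^ (critExp N 0 - ε))
        - 1 / (critExp N t - ε) *
          (∫ x in Ω.carrier, 1 / ‖x‖ ^ t * |v x| ^ (critExp N t - ε)) := by
      funext v
      simp only [energy, H10.integral_norm_grad_sq, Real.rpow_zero, div_one, one_mul,
        Real.rpow_two]
      simp only [one_div_mul_eq_div]
    rw [hfun, hasGradientAt_iff_hasFDerivAt]
    have hn := (hasStrictFDerivAt_norm_sq u).hasFDerivAt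
    have hd := (((hn.const_mul (1 / 2)).sub (hg₁.hasFDerivAt.const_mul (1 / 2))).sub
      (hg₂.hasFDerivAt.const_mul (μ / (critExp N 0 - ε)))).sub
      (hg₃.hasFDerivAt.const_mul (1 / (critExp N t - ε)))
    refine hd.congr_fderiv ?_
    ext φ
    simp only [sub_apply, smul_apply, InnerProductSpace.toDual_apply_apply,
      innerSL_apply_apply, smul_eq_mul, nsmul_eq_mul, inner_sub_left, inner_add_left,
      real_inner_smul_left]
    push_cast
    field_simp
    ring
  · rw [inner_add_left, inner_add_left, real_inner_smul_left, hk₁, hk₂, hk₃]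
    rfl

lemma differentiable_energy (h : EnergyWeights Ω a t ε Ca C₀ Ct) (μ : ℝ) :
    Differentiable ℝ (energy Ω a μ t ε) := fun u => by
  obtain ⟨k, hk, -⟩ := h.exists_hasGradientAt_energy μ u
  exact hk.differentiableAt

lemma inner_opK (h : EnergyWeights Ω a t ε Ca C₀ Ct) (μ : ℝ) (u φ : H10 Ω) :
    inner ℝ (opK Ω a μ t ε u) φ = pairing a 2 u φ
      + μ * pairing (fun x => 1 / ‖x‖ ^ (0 : ℝ)) (critExp N 0 - ε) u φ
      + pairing (fun x => 1 / ‖x‖ ^ t) (critExp N t - ε) u φ := by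
  obtain ⟨k, hk, hk'⟩ := h.exists_hasGradientAt_energy μ u
  rw [opK, hk.gradient, sub_sub_cancel, hk']

lemma opK_neg (h : EnergyWeights Ω a t ε Ca C₀ Ct) (μ : ℝ) (u : H10 Ω) :
    opK Ω a μ t ε (-u) = -opK Ω a μ t ε u := by
  refine ext_inner_right ℝ fun φ => ?_
  rw [inner_neg_left, h.inner_opK, h.inner_opK, pairing_neg_left, pairing_neg_left,
    pairing_neg_left]
  ring

/-- The negative part of `K(u)` is controlled by the distance of `u` from the cone. -/
lemma norm_negPart_opK_le (h : EnergyWeights Ω a t ε Ca C₀ Ct) {μ : ℝ} (hμ : 0 ≤ μ)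
    {u w vn : H10 Ω} (hw : w ∈ cone Ω) (hvn : vn ∈ cone Ω)
    (hv : ‖vn‖ ^ 2 ≤ -inner ℝ (opK Ω a μ t ε u) vn) :
    ‖vn‖ ≤ (Ca + μ * C₀ * ‖u - w‖ ^ (critExp N 0 - ε - 2)
      + Ct * ‖u - w‖ ^ (critExp N t - ε - 2)) * ‖u - w‖ := by
  have hsplit {p : ℝ} (hp : 2 ≤ p) :
      ‖u - w‖ ^ (p - 1) = ‖u - w‖ ^ (p - 2) * ‖u - w‖ := by
    nth_rewrite 3 [← Real.rpow_one ‖u - w‖]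
    rw [← Real.rpow_add_of_nonneg (norm_nonneg _) (by linarith) (by norm_num)]
    congr 1; ring
  rw [h.inner_opK] at hv
  have h1 := h.linear.neg_pairing_le le_rfl (u := u) hw hvn
  have h2 := mul_le_mul_of_nonneg_left (h.pow.neg_pairing_le h.two_le_pow (u := u) hw hvn) hμ
  have h3 := h.singular.neg_pairing_le h.two_le_singular (u := u) hw hvn
  rw [hsplit le_rfl, sub_self, Real.rpow_zero, one_mul] at h1
  rw [hsplit h.two_le_pow] at h2
  rw [hsplit h.two_le_singular] at h3
  rcases (norm_nonneg vn).eq_or_lt with h0 | h0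
  · have := h.linear_nonneg
    have := h.pow_nonneg
    have := h.singular_nonneg
    rw [← h0]
    positivity
  · refine le_of_mul_le_mul_right ?_ h0
    rw [← sq]
    refine hv.trans ?_
    linarith

end EnergyWeights

/-! ### The constants -/

/-- The constant of the linear term is `1 / λ₁`, by the definition of `λ₁`. -/
lemma isWeight_linear {a : EuclideanSpace ℝ (Fin N) → ℝ} (ha : IsC1Closure Ω.carrier a)
    (ha_pos : ∀ x ∈ Ω.carrier, 0 < a x) (hlam : 0 < lambda1 Ω a) :
    IsWeight Ω a 2 (lambda1 Ω a)⁻¹ := by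
  have hmem : ∀ᵐ x ∂(volume.restrict Ω.carrier), x ∈ Ω.carrier :=
    ae_restrict_mem Ω.isOpen.measurableSet
  have hnn : ∀ᵐ x ∂(volume.restrict Ω.carrier), 0 ≤ a x := by
    filter_upwards [hmem] with x hx using (ha_pos x hx).le
  have hmeas : AEStronglyMeasurable a (volume.restrict Ω.carrier) :=
    (ha.1.mono subset_closure).aestronglyMeasurable Ω.isOpen.measurableSet
  obtain ⟨M, hM⟩ := Ω.isBounded.isCompact_closure.exists_bound_of_continuousOn ha.1
  have hnn' (u : H10 Ω) : 0 ≤ ∫ x in Ω.carrier, a x * u x ^ 2 :=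
    integral_nonneg_of_ae (by
      filter_upwards [hnn] with x hx
      simp only [Pi.zero_apply]
      positivity)
  refine ⟨hnn, hmeas.aemeasurable, fun u => ?_, fun u => ?_⟩
  · simp only [Real.rpow_two, sq_abs]
    refine Integrable.bdd_mul (Lp.memLp u.val).integrable_sq hmeas (c := M) ?_
    filter_upwards [hmem] with x hx using hM x (subset_closure hx)
  · simp only [Real.rpow_two, sq_abs]
    rw [inv_mul_eq_div, le_div_iff₀ hlam]
    rcases (hnn' u).eq_or_lt with h0 | h0
    · rw [← h0, zero_mul]; positivity
    · have hu : u ≠ 0 := by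
        rintro rfl
        refine h0.ne' ?_
        rw [integral_congr_ae (g := fun x => (0 : ℝ)) (by
          filter_upwards [H10.coeFn_zero (Ω := Ω)] with x hx
          rw [hx]; simp), integral_zero]
      have hle : lambda1 Ω a ≤ ‖u‖ ^ 2 / ∫ x in Ω.carrier, a x * u x ^ 2 := by
        refine csInf_le ⟨0, ?_⟩ ⟨u, hu, by rw [H10.integral_norm_grad_sq]⟩
        rintro r ⟨v, -, rfl⟩
        exact div_nonneg (integral_nonneg fun x => by positivity) (hnn' v)
      rw [le_div_iff₀ h0] at hle
      linarith

lemma critExp_le_critExp_zero (Ω : BoundedDomain N) {t : ℝ} (ht : 0 ≤ t) :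
    critExp N t ≤ critExp N 0 := by
  have hN : (3 : ℝ) ≤ N := by exact_mod_cast Ω.three_le
  unfold critExp
  exact div_le_div_of_nonneg_right (by linarith) (by linarith)

/-- All constants are independent of `ε`. -/
lemma exists_energyWeights {a : EuclideanSpace ℝ (Fin N) → ℝ} (ha : IsC1Closure Ω.carrier a)
    (ha_pos : ∀ x ∈ Ω.carrier, 0 < a x) (hlam : 0 < lambda1 Ω a) {t : ℝ}
    (ht : t ∈ Ioo (0 : ℝ) 2) :
    ∃ C₀ Ct : ℝ, 0 ≤ C₀ ∧ 0 ≤ Ct ∧ ∀ ε, 0 ≤ ε → 2 ≤ critExp N t - ε →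
      EnergyWeights Ω a t ε (lambda1 Ω a)⁻¹ C₀ Ct := by
  obtain ⟨C₀, hC₀, h₀⟩ := exists_isWeight Ω le_rfl (zero_lt_two (α := ℝ))
  obtain ⟨Ct, hCt, ht'⟩ := exists_isWeight Ω ht.1.le ht.2
  have hle := critExp_le_critExp_zero Ω ht.1.le
  refine ⟨C₀, Ct, hC₀, hCt, fun ε hε h2 => ⟨isWeight_linear ha ha_pos hlam,
    h₀ _ (by linarith) (by linarith), ht' _ h2 (by linarith), by positivity, hC₀, hCt,
    by linarith, h2⟩⟩

/-- `K` contracts the distance from the cone by a factor `κ < 1` which does not depend on `ε`,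
as long as the distance is less than `Δ`. -/
lemma exists_contraction {a : EuclideanSpace ℝ (Fin N) → ℝ} (ha : IsC1Closure Ω.carrier a)
    (ha_pos : ∀ x ∈ Ω.carrier, 0 < a x) (hlam : 1 < lambda1 Ω a) {μ t ε₀ : ℝ} (hμ : 0 ≤ μ)
    (ht : t ∈ Ioo (0 : ℝ) 2) (hε₀ : ε₀ < critExp N t - 2) :
    ∃ Δ > 0, ∃ κ ∈ Ioo (0 : ℝ) 1, ∀ ε ∈ Ioo 0 ε₀, ∀ u : H10 Ω, ∃ vp ∈ cone Ω, ∃ vn ∈ cone Ω,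
      opK Ω a μ t ε u = vp - vn ∧ ∀ w ∈ cone Ω, ‖u - w‖ < Δ → ‖vn‖ ≤ κ * ‖u - w‖ := by
  obtain ⟨C₀, Ct, hC₀, hCt, hW⟩ := exists_energyWeights ha ha_pos (zero_lt_one.trans hlam) ht
  set κ₀ := (lambda1 Ω a)⁻¹ with hκ₀
  have hκ₀0 : 0 < κ₀ := inv_pos.mpr (zero_lt_one.trans hlam)
  have hκ₀1 : κ₀ < 1 := inv_lt_one_of_one_lt₀ hlam
  set σ := critExp N t - ε₀ - 2 with hσdef
  have hσ : 0 < σ := by linarith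
  set B := μ * C₀ + Ct
  have hB : 0 ≤ B := by positivity
  -- the nonlinear terms contribute at most `B Δ^σ`, which has to fit into the gap `(1 - κ₀) / 2`
  have hgap : 0 < (1 - κ₀) / 2 / (B + 1) := by
    have : 0 < 1 - κ₀ := by linarith
    positivity
  set Δ := min 1 (((1 - κ₀) / 2 / (B + 1)) ^ (1 / σ))
  have hΔ : 0 < Δ := lt_min one_pos (Real.rpow_pos_of_pos hgap _)
  refine ⟨Δ, hΔ, (1 + κ₀) / 2, ⟨by linarith, by linarith⟩, fun ε hε u => ?_⟩
  have hE := hW ε hε.1.le (by linarith [hε.2])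
  obtain ⟨vp, vn, hvp, hvn, hv, hle⟩ := (opK Ω a μ t ε u).exists_posPart_negPart
  refine ⟨vp, hvp, vn, hvn, hv, fun w hw huw => ?_⟩
  refine (hE.norm_negPart_opK_le hμ hw hvn hle).trans ?_
  refine mul_le_mul_of_nonneg_right ?_ (norm_nonneg _)
  have hsmall {p : ℝ} (hp : σ ≤ p) : ‖u - w‖ ^ p ≤ (1 - κ₀) / 2 / (B + 1) := by
    rcases (norm_nonneg (u - w)).eq_or_lt with h0 | h0
    · rw [← h0, Real.zero_rpow (by linarith)]; exact hgap.le
    · calc ‖u - w‖ ^ p ≤ ‖u - w‖ ^ σ :=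
            Real.rpow_le_rpow_of_exponent_ge h0 (huw.le.trans (min_le_left _ _)) hp
        _ ≤ (((1 - κ₀) / 2 / (B + 1)) ^ (1 / σ)) ^ σ := by
            gcongr
            exact huw.le.trans (min_le_right _ _)
        _ = _ := by rw [← Real.rpow_mul hgap.le, one_div_mul_cancel hσ.ne', Real.rpow_one]
  have hcrit := critExp_le_critExp_zero Ω ht.1.le
  have h1 := hsmall (p := critExp N 0 - ε - 2) (by linarith [hε.2])
  have h2 := hsmall (p := critExp N t - ε - 2) (by linarith [hε.2])
  calc κ₀ + μ * C₀ * ‖u - w‖ ^ (critExp N 0 - ε - 2) + Ct * ‖u - w‖ ^ (critExp N t - ε - 2)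
      ≤ κ₀ + μ * C₀ * ((1 - κ₀) / 2 / (B + 1)) + Ct * ((1 - κ₀) / 2 / (B + 1)) := by gcongr
    _ = κ₀ + B / (B + 1) * ((1 - κ₀) / 2) := by simp only [B]; ring
    _ ≤ κ₀ + 1 * ((1 - κ₀) / 2) := by
        have h3 : B / (B + 1) ≤ 1 := (div_le_one (by linarith)).mpr (by linarith)
        have h4 : 0 ≤ (1 - κ₀) / 2 := by linarith
        gcongr
    _ = (1 + κ₀) / 2 := by ring

/-! ### Invariance of the neighbourhoods of the cone -/

lemma zero_mem_cone : (0 : H10 Ω) ∈ cone Ω := by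
  change ∀ᵐ x ∂_, _
  filter_upwards [H10.coeFn_zero (Ω := Ω)] with x hx
  rw [hx]

lemma mem_nbhd_iff {δ : ℝ} {u : H10 Ω} : u ∈ nbhd Ω δ ↔ ∃ w ∈ cone Ω, ‖u - w‖ < δ := by
  simp_rw [← dist_eq_norm]
  exact Metric.infDist_lt_iff ⟨0, zero_mem_cone⟩

lemma nbhd_mono {δ δ' : ℝ} (h : δ ≤ δ') : nbhd Ω δ ⊆ nbhd Ω δ' :=
  fun _ hu => lt_of_lt_of_le (show _ < δ from hu) h

lemma opK_eq_self_of_mem_critPts {a : EuclideanSpace ℝ (Fin N) → ℝ} {μ t ε : ℝ} {u : H10 Ω}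
    (hu : u ∈ critPts Ω a μ t ε) : opK Ω a μ t ε u = u := by
  rw [opK, show gradient _ u = 0 from hu, sub_zero]

/-- A map which contracts the distance from the cone below the distance `Δ` maps `D(δ₀)` into
`D(κ δ₀)`, and its fixed points in `D(δ₀)` lie in the cone. -/
lemma nbhd_invariant_of_contraction {K : H10 Ω → H10 Ω} {Δ κ δ₀ : ℝ} (hκ0 : 0 < κ)
    (hκ1 : κ < 1) (hδ₀ : δ₀ ≤ Δ)
    (hK : ∀ u : H10 Ω, ∃ vp ∈ cone Ω, ∃ vn ∈ cone Ω,
      K u = vp - vn ∧ ∀ w ∈ cone Ω, ‖u - w‖ < Δ → ‖vn‖ ≤ κ * ‖u - w‖) :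
    (∀ u ∈ nbhd Ω δ₀, K u ∈ nbhd Ω (κ * δ₀)) ∧ ∀ u ∈ nbhd Ω δ₀, K u = u → u ∈ cone Ω := by
  refine ⟨fun u hu => ?_, fun u hu hfix => ?_⟩
  · obtain ⟨w, hw, huw⟩ := mem_nbhd_iff.mp hu
    obtain ⟨vp, hvp, vn, -, hv, hle⟩ := hK u
    refine mem_nbhd_iff.mpr ⟨vp, hvp, ?_⟩
    rw [hv, sub_sub_cancel_left, norm_neg]
    exact (hle w hw (huw.trans_le hδ₀)).trans_lt (mul_lt_mul_of_pos_left huw hκ0)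
  · obtain ⟨w, hw, huw⟩ := mem_nbhd_iff.mp hu
    obtain ⟨vp, hvp, vn, -, hv, hle⟩ := hK u
    rw [hfix] at hv
    have hdist : ‖u - vp‖ = ‖vn‖ := by
      nth_rewrite 1 [hv]; rw [sub_sub_cancel_left, norm_neg]
    have h1 := hle w hw (huw.trans_le hδ₀)
    have h2 : ‖vn‖ ≤ ‖u - w‖ := h1.trans (mul_le_of_le_one_left (norm_nonneg _) hκ1.le)
    -- with `w = vp`, the distance `‖vn‖` is bounded by `κ` times itself
    have h3 := hle vp hvp (by rw [hdist]; linarith)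
    rw [hdist] at h3
    have h4 : ‖vn‖ = 0 := by nlinarith [norm_nonneg vn]
    rw [hv, norm_eq_zero.mp h4, sub_zero]
    exact hvp

end HardySobolev

theorem proposition1 {N : ℕ} (Ω : HardySobolev.BoundedDomain N)
    (a : EuclideanSpace ℝ (Fin N) → ℝ) (ha : HardySobolev.IsC1Closure Ω.carrier a)
    (ha_pos : ∀ x ∈ Ω.carrier, 0 < a x)
    (μ t : ℝ) (hμ : 0 ≤ μ) (ht : t ∈ Ioo (0 : ℝ) 2)
    (ε₀ : ℝ) (hε₀ : ε₀ < HardySobolev.critExp N t - 2)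
    (ε : ℕ → ℝ) (hε : ∀ n, ε n ∈ Ioo 0 ε₀)
    (hlam : 1 < HardySobolev.lambda1 Ω a) :
    (∀ n, Differentiable ℝ (HardySobolev.energy Ω a μ t (ε n))) ∧
    ∃ Δ > 0, ∀ δ₀ ∈ Ioo 0 Δ,
      (∃ δ ∈ Ioo 0 δ₀, ∀ n,
        HardySobolev.opK Ω a μ t (ε n) '' HardySobolev.nbhd Ω δ₀ ⊆ HardySobolev.nbhd Ω δ ∧
        HardySobolev.nbhd Ω δ ⊆ HardySobolev.nbhd Ω δ₀ ∧
        HardySobolev.opK Ω a μ t (ε n) '' (-HardySobolev.nbhd Ω δ₀) ⊆ -HardySobolev.nbhd Ω δ ∧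
        -HardySobolev.nbhd Ω δ ⊆ -HardySobolev.nbhd Ω δ₀) ∧
      ∀ n,
        HardySobolev.nbhd Ω δ₀ ∩ HardySobolev.critPts Ω a μ t (ε n) ⊆ HardySobolev.cone Ω ∧
        -HardySobolev.nbhd Ω δ₀ ∩ HardySobolev.critPts Ω a μ t (ε n) ⊆ -HardySobolev.cone Ω := by
  have hdiff : ∀ n, ∃ Ca C₀ Ct, HardySobolev.EnergyWeights Ω a t (ε n) Ca C₀ Ct := fun n => by
    obtain ⟨C₀, Ct, -, -, hW⟩ :=
      HardySobolev.exists_energyWeights ha ha_pos (zero_lt_one.trans hlam) ht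
    exact ⟨_, _, _, hW (ε n) (hε n).1.le (by linarith [(hε n).2])⟩
  choose Ca C₀ Ct hE using hdiff
  obtain ⟨Δ, hΔ, κ, hκ, hK⟩ := HardySobolev.exists_contraction ha ha_pos hlam hμ ht hε₀
  refine ⟨fun n => (hE n).differentiable_energy μ, Δ, hΔ, fun δ₀ hδ₀ => ?_⟩
  have hlt : κ * δ₀ < δ₀ := mul_lt_of_lt_one_left hδ₀.1 hκ.2
  have hsub := HardySobolev.nbhd_mono (Ω := Ω) hlt.le
  have hinv (n : ℕ) := HardySobolev.nbhd_invariant_of_contraction hκ.1 hκ.2 hδ₀.2.le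
    (hK (ε n) (hε n))
  refine ⟨⟨κ * δ₀, ⟨mul_pos hκ.1 hδ₀.1, hlt⟩, fun n => ⟨?_, hsub, ?_, Set.neg_subset_neg.mpr hsub⟩⟩,
    fun n => ⟨?_, ?_⟩⟩
  · rintro _ ⟨u, hu, rfl⟩
    exact (hinv n).1 u hu
  · rintro _ ⟨u, hu, rfl⟩
    rw [Set.mem_neg, ← (hE n).opK_neg]
    exact (hinv n).1 (-u) hu
  · rintro u ⟨hu, hcrit⟩
    exact (hinv n).2 u hu (HardySobolev.opK_eq_self_of_mem_critPts hcrit)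
  · rintro u ⟨hu, hcrit⟩
    refine (hinv n).2 (-u) hu ?_
    rw [(hE n).opK_neg, HardySobolev.opK_eq_self_of_mem_critPts hcrit]
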